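/- Let $K,D,L$ be positive integers with $L\le D\le K$, let $\mathbb F_p$ be a finite field of order $p$ and $\mathbb F_q$ a finite extension field of $\mathbb F_p$. Let $\mathscr W$ be the set of all $D$-subsets of $\{1,\dots,K\}$, and let $\mathscr V$ be the set of all $L\times D$ matrices over $\mathbb F_p$ that are generator matrices of an $L$-dimensional MDS code of length $D$; assume that $\mathscr V\neq\emptyset$. Let $\mathbf W$, $\mathbf V$, $\mathbf X=(\mathbf X_1,\dots,\mathbf X_K)$ be independent and uniformly distributed over $\mathscr W$, $\mathscr V$, $\mathbb F_q^K$, respectively. The demand is $\mathbf Z=\mathbf V\mathbf X_{\mathbf W}$, where $\mathbf X_{\mathbf W}$ is the vector of the messages with index in $\mathbf W$, in increasing order of the index. A protocol for single-server private linear transformation with individual privacy (IPLT) consists of a discrete random query $\mathbf Q$, drawn from a distribution that depends on $(\mathbf W,\mathbf V)$, independently of $\mathbf X$ given $(\mathbf W,\mathbf V)$, and an answer $\mathbf A$ that is a deterministic function of $(\mathbf Q,\mathbf X)$, such that (individual privacy) $\Pr(i\in\mathbf W\mid\mathbf Q=\mathrm Q)=\Pr(i\in\mathbf W)$ for every $i\in\{1,\dots,K\}$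 and every $\mathrm Q$ with $\Pr(\mathbf Q=\mathrm Q)>0$; (recoverability) $H(\mathbf Z\mid\mathbf A,\mathbf Q,\mathbf W,\mathbf V)=0$. Its rate is $H(\mathbf Z)/H(\mathbf A)$, and the capacity is the supremum of the rates over all IPLT protocols. Put $R=K\bmod D$ and $S=\gcd(D+R,R)$. (1) For all $\mathbb F_p$ and $\mathbb F_q$ as above, the capacity is at most $$\Bigl(\Bigl\lfloor\tfrac KD\Bigr\rfloor+\min\Bigl\{1,\tfrac RL\Bigr\}\Bigr)^{-1}.$$ (2) If $p$ is sufficiently large, that is, $p\ge N$ for some $N$ that depends only on $K,D,L$, then $\mathscr V\ne\emptyset$ and, for every $\mathbb F_q$, the capacity is at least $$\Bigl(\Bigl\lfloor\tfrac KD\Bigr\rfloor+\min\Bigl\{\tfrac RS,\tfrac RL\Bigr\}\Bigr)^{-1}.$$ (3) The two bounds coincide when $R\le L$ or $R\mid D$. -/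

import Mathlib

open scoped ENNReal

universe u

namespace IPLT

/-! Discrete entropy, in bits, with values in `[0, ∞]`. -/

/-- The number `t * log₂ (1 / t)`, with the convention `0 * log₂ (1 / 0) = 0`. -/
noncomputable def bits (t : ℝ≥0∞) : ℝ≥0∞ :=
  ENNReal.ofReal (Real.negMulLog t.toReal / Real.log 2)

/-- The Shannon entropy `H(Y)` of a discrete random variable `Y` on `(Ω, μ)`. -/
noncomputable def entropy {Ω α : Type*} (μ : PMF Ω) (Y : Ω → α) : ℝ≥0∞ :=
  ∑' a, bits (μ.map Y a)

/-- The conditional entropy `H(Z | Y) = ∑ y, Pr(Y = y) * H(Z | Y = y)`. -/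
noncomputable def condEntropy {Ω α β : Type*} (μ : PMF Ω) (Z : Ω → α) (Y : Ω → β) : ℝ≥0∞ :=
  ∑' y, μ.map Y y * ∑' z, bits (μ.map (fun ω => (Z ω, Y ω)) (z, y) / μ.map Y y)

/-- The probability of an event. -/
noncomputable def prob {Ω : Type*} (μ : PMF Ω) (s : Set Ω) : ℝ≥0∞ :=
  μ.toOuterMeasure s

/-- The conditional probability `Pr(s | t)`, for an event `t` of positive probability. -/
noncomputable def condProb {Ω : Type*} (μ : PMF Ω) (s t : Set Ω) : ℝ≥0∞ :=
  prob μ (s ∩ t) / prob μ t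

/-! Support index sets and coefficient matrices of demands. -/

/-- The `D`-subsets of the `K` message indices. -/
abbrev Support (K D : ℕ) : Type := {W : Finset (Fin K) // W.card = D}

theorem Support.nonempty {K D : ℕ} (h : D ≤ K) : Nonempty (Support K D) := by
  obtain ⟨W, -, hW⟩ := Finset.exists_subset_card_eq (s := (Finset.univ : Finset (Fin K)))
    (n := D) (by simpa using h)
  exact ⟨⟨W, hW⟩⟩

open Classical in
/-- A linear code of length `n` is MDS if its minimum distance is at least
(hence, by the Singleton bound, equal to) `n - dim + 1`. -/
def IsMDSCode {F : Type*} [Field F] {n : ℕ} (C : Submodule F (Fin n → F)) : Prop :=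
  ∀ c ∈ C, c ≠ 0 → n + 1 ≤ hammingNorm c + Module.finrank F C

/-- An `L × D` matrix is a generator matrix of an `L`-dimensional MDS code of length `D`. -/
def GeneratesMDS {F : Type*} [Field F] {L D : ℕ} (V : Matrix (Fin L) (Fin D) F) : Prop :=
  LinearIndependent F V.row ∧ IsMDSCode (Submodule.span F (Set.range V.row))

/-- The `L × D` matrices over `F` that generate an MDS code. -/
abbrev MDSMatrix (F : Type*) [Field F] (L D : ℕ) : Type _ :=
  {V : Matrix (Fin L) (Fin D) F // GeneratesMDS V}

noncomputable instance {F : Type*} [Field F] [Fintype F] {L D : ℕ} :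
    Fintype (MDSMatrix F L D) := Fintype.ofFinite _

noncomputable instance {K D : ℕ} : Fintype (Support K D) := Fintype.ofFinite _

/-- The demand `V X_W`, where `X_W` lists the messages with index in `W` in increasing order
of the index. -/
def demand {F E : Type*} [Field F] [Field E] [Algebra F E] {K D L : ℕ}
    (W : Support K D) (V : MDSMatrix F L D) (X : Fin K → E) : Fin L → E :=
  (V.1.map (algebraMap F E)).mulVec fun j => X (W.1.orderEmbOfFin W.2 j)

/-! Protocols. -/

/-- A rule by which the user draws a query at random given `(W, V)`, and a rule by which the
server computes its answer from the query and the messages. -/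
structure Scheme (F E : Type u) [Field F] (K D L : ℕ) where
  Query : Type u
  Answer : Type u
  query : Support K D → MDSMatrix F L D → PMF Query
  answer : Query → (Fin K → E) → Answer

/-- The values taken by the support index set, the coefficient matrix, the messages and the
query. -/
structure Outcome (F E : Type u) [Field F] (K D L : ℕ) (Query : Type u) where
  W : Support K D
  V : MDSMatrix F L D
  X : Fin K → E
  Q : Query

namespace Scheme

variable {F E : Type u} [Field F] [Fintype F] [Field E] [Fintype E] [Algebra F E] {K D L : ℕ}

/-- The joint law: `W`, `V`, `X` are independent and uniform, and the query is drawn given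
`(W, V)`, independently of `X`. -/
noncomputable def law (P : Scheme F E K D L) (hDK : D ≤ K) (hV : Nonempty (MDSMatrix F L D)) :
    PMF (Outcome F E K D L P.Query) :=
  haveI : Nonempty (Support K D) := Support.nonempty hDK
  (PMF.uniformOfFintype (Support K D)).bind fun W =>
    (PMF.uniformOfFintype (MDSMatrix F L D)).bind fun V =>
      (PMF.uniformOfFintype (Fin K → E)).bind fun X =>
        (P.query W V).map fun Q => ⟨W, V, X, Q⟩

/-- The demand as a random variable. -/
def Z (P : Scheme F E K D L) (ω : Outcome F E K D L P.Query) : Fin L → E :=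
  demand ω.W ω.V ω.X

/-- The answer as a random variable. -/
def A (P : Scheme F E K D L) (ω : Outcome F E K D L P.Query) : P.Answer :=
  P.answer ω.Q ω.X

/-- Individual privacy: `Pr(i ∈ W | Q = q) = Pr(i ∈ W)` for every message index `i` and every
query `q` that occurs with positive probability. -/
def IndividuallyPrivate (P : Scheme F E K D L) (hDK : D ≤ K)
    (hV : Nonempty (MDSMatrix F L D)) : Prop :=
  ∀ q : P.Query, prob (P.law hDK hV) {ω | ω.Q = q} ≠ 0 →
    ∀ i : Fin K, condProb (P.law hDK hV) {ω | i ∈ ω.W.1} {ω | ω.Q = q} =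
      prob (P.law hDK hV) {ω | i ∈ ω.W.1}

/-- Recoverability: `H(Z | A, Q, W, V) = 0`. -/
def Recoverable (P : Scheme F E K D L) (hDK : D ≤ K)
    (hV : Nonempty (MDSMatrix F L D)) : Prop :=
  condEntropy (P.law hDK hV) P.Z (fun ω => (P.A ω, ω.Q, ω.W, ω.V)) = 0

/-- A protocol is a scheme that is individually private and recoverable. -/
def IsProtocol (P : Scheme F E K D L) (hDK : D ≤ K) (hV : Nonempty (MDSMatrix F L D)) : Prop :=
  P.IndividuallyPrivate hDK hV ∧ P.Recoverable hDK hV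

/-- The rate `H(Z) / H(A)`. -/
noncomputable def rate (P : Scheme F E K D L) (hDK : D ≤ K)
    (hV : Nonempty (MDSMatrix F L D)) : ℝ≥0∞ :=
  entropy (P.law hDK hV) P.Z / entropy (P.law hDK hV) P.A

end Scheme

/-- The capacity: the supremum of the rates of all protocols. -/
noncomputable def capacity (F E : Type u) [Field F] [Fintype F] [Field E] [Fintype E]
    [Algebra F E] {K D L : ℕ} (hDK : D ≤ K) (hV : Nonempty (MDSMatrix F L D)) : ℝ≥0∞ :=
  ⨆ (P : Scheme F E K D L) (_ : P.IsProtocol hDK hV), P.rate hDK hV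

/-- The number `(⌊K/D⌋ + min {R/S, R/L})⁻¹` with `R = K mod D` and `S = gcd (D + R, R)`. -/
noncomputable def lowerBound (K D L : ℕ) : ℝ :=
  (((K / D : ℕ) : ℝ) +
    min (((K % D : ℕ) : ℝ) / (Nat.gcd (D + K % D) (K % D) : ℝ)) (((K % D : ℕ) : ℝ) / (L : ℝ)))⁻¹

/-- The number `(⌊K/D⌋ + min {1, R/L})⁻¹` with `R = K mod D`. -/
noncomputable def upperBound (K D L : ℕ) : ℝ :=
  (((K / D : ℕ) : ℝ) + min 1 (((K % D : ℕ) : ℝ) / (L : ℝ)))⁻¹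

end IPLT

namespace IPLT

/-! ### Bounds for the entropy -/

/-! Upper bound. Fix a query that occurs. By individual privacy every message index lies in some
support compatible with this query, and by recoverability the answer determines every compatible
demand. Absorb the compatible supports one after another: a support with `k` new indices contributes
`min L k` new independent symbols, because any `L` columns of an MDS generator matrix are
independent. By the time all `K` indices are absorbed there are at least `L * (K / D) + min L (K %
D)` of them (`coverage_step`, `exists_determined`). No answer then has conditional probability above
`|E|` to minus this number, which bounds `H(A)` from below, while `H(Z)` is at most `L * log |E|`
(`capacity_le`).

Lower bound. With `R = K % D` and `S = gcd (D + R, R)`, arrange the messages at random into `K / D -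
1` blocks of size `D` and one cycle of `(D + R) / S` groups of size `S`. The candidate supports are
the blocks, with weight `D`, and the cyclic windows of `D / S` groups, with weight `S`; every
message is covered with weight `D` out of a total of `K`, which gives individual privacy
(`place_cover`). The codes on the candidates are read off from an arc, a family of vectors in `F ^
k` of which any `k` are independent. In `le_capacity_of_aligned` polynomial multipliers make the
window codes lie in a common space; in `le_capacity_of_shortened` the window codes are shortenings
of one long MDS code. The first is used for `L ≤ S`, the second for `S ≤ L`.

The coefficient matrix must not betray which candidate is the true one. This calls for a random arc
whose restriction to any `D` points is uniform among arcs with `D` points. For a large field almost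
every extension of a partial arc is an arc, so the linear system for the required weights is a small
perturbation of a solvable one and has a nonnegative solution (`exists_weight`,
`exists_arc_weight`). -/

theorem bits_eq_zero_iff {t : ℝ≥0∞} (ht : t ≤ 1) : bits t = 0 ↔ t = 0 ∨ t = 1 := by
  have htop : t ≠ ∞ := ne_top_of_le_ne_top ENNReal.one_ne_top ht
  have h2 : (0 : ℝ) < Real.log 2 := Real.log_pos (by norm_num)
  have h1 : t.toReal ≤ 1 := by simpa using ENNReal.toReal_mono ENNReal.one_ne_top ht
  unfold bits
  rw [ENNReal.ofReal_eq_zero]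
  constructor
  · intro h
    have h' : Real.negMulLog t.toReal ≤ 0 := by
      by_contra hc
      push Not at hc
      exact absurd h (not_le.2 (div_pos hc h2))
    have h'' : Real.negMulLog t.toReal = 0 :=
      le_antisymm h' (Real.negMulLog_nonneg ENNReal.toReal_nonneg h1)
    rw [Real.negMulLog, neg_mul, neg_eq_zero, mul_eq_zero] at h''
    have h0 : (0 : ℝ) ≤ t.toReal := ENNReal.toReal_nonneg
    rcases h'' with h | h
    · left; exact (ENNReal.toReal_eq_zero_iff t).1 h |>.resolve_right htop
    · rcases Real.log_eq_zero.1 h with h | h | h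
      · left; exact (ENNReal.toReal_eq_zero_iff t).1 h |>.resolve_right htop
      · right; exact (ENNReal.toReal_eq_one_iff t).1 h
      · linarith
  · rintro (rfl | rfl) <;> simp

theorem mul_log_le_bits {t : ℝ≥0∞} {M : ℕ} (hM : 1 ≤ M) (ht : t ≤ (M : ℝ≥0∞)⁻¹) :
    t * ENNReal.ofReal (Real.log M / Real.log 2) ≤ bits t := by
  have htop : t ≠ ∞ := ne_top_of_le_ne_top (by simp; omega) ht
  have h2 : (0 : ℝ) < Real.log 2 := Real.log_pos (by norm_num)
  have hM' : (0 : ℝ) < M := by exact_mod_cast hM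
  have h1 : t.toReal ≤ (M : ℝ)⁻¹ := by
    have := ENNReal.toReal_mono (by simp; omega) ht
    simpa using this
  rw [← ENNReal.ofReal_toReal htop, ← ENNReal.ofReal_mul ENNReal.toReal_nonneg]
  unfold bits
  rw [ENNReal.ofReal_toReal htop]
  apply ENNReal.ofReal_le_ofReal
  rw [← mul_div_assoc]
  apply div_le_div_of_nonneg_right _ h2.le
  rw [Real.negMulLog_def]
  rcases eq_or_lt_of_le (ENNReal.toReal_nonneg (a := t)) with h0 | h0
  · simp [← h0]
  · have : Real.log t.toReal ≤ Real.log ((M : ℝ)⁻¹) := Real.log_le_log h0 h1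
    rw [Real.log_inv] at this
    nlinarith

/-- Entropy dominates min-entropy: every value has surprisal at least `log₂ M`. -/
theorem log_card_le_entropy {Ω α : Type*} (μ : PMF Ω) (Y : Ω → α) {M : ℕ} (hM : 1 ≤ M)
    (h : ∀ a, μ.map Y a ≤ (M : ℝ≥0∞)⁻¹) :
    ENNReal.ofReal (Real.log M / Real.log 2) ≤ entropy μ Y := by
  calc ENNReal.ofReal (Real.log M / Real.log 2)
      = ∑' a, μ.map Y a * ENNReal.ofReal (Real.log M / Real.log 2) := by
        rw [ENNReal.tsum_mul_right, PMF.tsum_coe, one_mul]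
    _ ≤ entropy μ Y := ENNReal.tsum_le_tsum fun a => mul_log_le_bits hM (h a)

theorem entropy_le_log_card {Ω α : Type*} [Fintype α] [Nonempty α] (μ : PMF Ω) (Y : Ω → α) :
    entropy μ Y ≤ ENNReal.ofReal (Real.log (Fintype.card α) / Real.log 2) := by
  have h2 : (0 : ℝ) < Real.log 2 := Real.log_pos (by norm_num)
  have hn : (0 : ℝ) < Fintype.card α := by exact_mod_cast Fintype.card_pos
  set n : ℝ := (Fintype.card α : ℝ) with hndef
  have hle : ∀ a, (μ.map Y a).toReal ≤ 1 := fun a => by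
    simpa using ENNReal.toReal_mono ENNReal.one_ne_top (PMF.coe_le_one (μ.map Y) a)
  have hsum : ∑ a, (μ.map Y a).toReal = 1 := by
    rw [← ENNReal.toReal_sum fun a _ => PMF.apply_ne_top _ a, ← tsum_fintype (L := .unconditional α), PMF.tsum_coe]
    rfl
  unfold entropy bits
  rw [tsum_fintype, ← ENNReal.ofReal_sum_of_nonneg fun a _ =>
    div_nonneg (Real.negMulLog_nonneg ENNReal.toReal_nonneg (hle a)) h2.le, ← Finset.sum_div]
  apply ENNReal.ofReal_le_ofReal
  apply div_le_div_of_nonneg_right _ h2.le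
  -- The inequality `log x ≤ x - 1` at `x = 1 / (n * t)`; the correction terms `1 / n - t` sum to
  -- zero.
  have key : ∀ a, Real.negMulLog (μ.map Y a).toReal ≤
      (μ.map Y a).toReal * Real.log n + (1 / n - (μ.map Y a).toReal) := by
    intro a
    rcases eq_or_lt_of_le (ENNReal.toReal_nonneg (a := μ.map Y a)) with h0 | h0
    · rw [← h0]; simp [hn.le]
    · have := Real.log_le_sub_one_of_pos (x := 1 / (n * (μ.map Y a).toReal)) (by positivity)
      rw [one_div, Real.log_inv, Real.log_mul hn.ne' h0.ne'] at this
      have h3 := mul_le_mul_of_nonneg_left this h0.le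
      have h4 : (μ.map Y a).toReal * ((n * (μ.map Y a).toReal)⁻¹ - 1) =
          1 / n - (μ.map Y a).toReal := by field_simp
      rw [h4] at h3
      rw [Real.negMulLog_def]
      nlinarith
  calc ∑ a, Real.negMulLog (μ.map Y a).toReal
      ≤ ∑ a, ((μ.map Y a).toReal * Real.log n + (1 / n - (μ.map Y a).toReal)) :=
        Finset.sum_le_sum fun a _ => key a
    _ = Real.log n := by
        rw [Finset.sum_add_distrib, ← Finset.sum_mul, Finset.sum_sub_distrib, hsum]
        simp [← hndef, hn.ne']

/-- The conditional entropy vanishes exactly if `Z` is a function of `Y` almost surely. -/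
theorem condEntropy_eq_zero_iff {Ω α β : Type*} (μ : PMF Ω) (Z : Ω → α) (Y : Ω → β) :
    condEntropy μ Z Y = 0 ↔
      ∀ ω ∈ μ.support, ∀ ω' ∈ μ.support, Y ω = Y ω' → Z ω = Z ω' := by
  classical
  have hfst : ∀ z y, μ.map (fun ω => (Z ω, Y ω)) (z, y) ≤ μ.map Y y := by
    intro z y
    rw [PMF.map_apply, PMF.map_apply]
    refine ENNReal.tsum_le_tsum fun ω => ?_
    by_cases h : (z, y) = (Z ω, Y ω)
    · rw [if_pos h, if_pos (Prod.mk.inj h).2]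
    · rw [if_neg h]; exact zero_le
  have hdiv : ∀ z y, μ.map (fun ω => (Z ω, Y ω)) (z, y) / μ.map Y y ≤ 1 := fun z y =>
    ENNReal.div_le_of_le_mul (by simpa using hfst z y)
  unfold condEntropy
  simp only [ENNReal.tsum_eq_zero, mul_eq_zero, bits_eq_zero_iff (hdiv _ _)]
  constructor
  · intro h ω hω ω' hω' hY
    by_contra hne
    have hy : μ.map Y (Y ω) ≠ 0 := by
      rw [← PMF.mem_support_iff, PMF.mem_support_map_iff]; exact ⟨ω, hω, rfl⟩
    have hytop := PMF.apply_ne_top (μ.map Y) (Y ω)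
    have key : ∀ ω₁ ∈ μ.support, Y ω₁ = Y ω →
        μ.map (fun ω => (Z ω, Y ω)) (Z ω₁, Y ω) = μ.map Y (Y ω) := by
      intro ω₁ h₁ hY₁
      rcases (h (Y ω)).resolve_left hy (Z ω₁) with h0 | h0
      · exfalso
        have : μ.map (fun ω => (Z ω, Y ω)) (Z ω₁, Y ω) ≠ 0 := by
          rw [← PMF.mem_support_iff, PMF.mem_support_map_iff]; exact ⟨ω₁, h₁, by simp [hY₁]⟩
        rw [ENNReal.div_eq_zero_iff] at h0
        exact h0.elim this hytop
      · rwa [ENNReal.div_eq_one_iff hy hytop] at h0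
    have h1 := key ω hω rfl
    have h2 := key ω' hω' hY.symm
    -- Two distinct values of `Z` would each carry the full positive mass of the same value of `Y`.
    have h3 : μ.map (fun ω => (Z ω, Y ω)) (Z ω, Y ω) +
        μ.map (fun ω => (Z ω, Y ω)) (Z ω', Y ω) ≤ μ.map Y (Y ω) := by
      rw [PMF.map_apply, PMF.map_apply, PMF.map_apply, ← ENNReal.tsum_add]
      refine ENNReal.tsum_le_tsum fun ω₁ => ?_
      by_cases ha : Z ω = Z ω₁ <;> by_cases hb : Z ω' = Z ω₁ <;> by_cases hc : Y ω = Y ω₁ <;>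
        simp [ha, hb, hc]
      exact absurd (ha.trans hb.symm) hne
    rw [h1, h2] at h3
    have h4 : μ.map Y (Y ω) + 0 < μ.map Y (Y ω) + μ.map Y (Y ω) :=
      ENNReal.add_lt_add_left hytop (pos_iff_ne_zero.2 hy)
    rw [add_zero] at h4
    exact absurd h3 (not_le.2 h4)
  · intro h y
    by_cases hy : μ.map Y y = 0
    · exact Or.inl hy
    · right
      intro z
      have hytop := PMF.apply_ne_top (μ.map Y) y
      by_cases hz : μ.map (fun ω => (Z ω, Y ω)) (z, y) = 0
      · left; simp [hz]
      · right
        rw [ENNReal.div_eq_one_iff hy hytop]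
        rw [← ne_eq, ← PMF.mem_support_iff, PMF.mem_support_map_iff] at hz
        obtain ⟨ω₀, hω₀, he⟩ := hz
        obtain ⟨rfl, rfl⟩ := Prod.mk.inj he
        rw [PMF.map_apply, PMF.map_apply]
        refine tsum_congr fun ω => ?_
        by_cases hc : Y ω₀ = Y ω
        · by_cases hω : ω ∈ μ.support
          · simp [hc, h ω₀ hω₀ ω hω hc]
          · have : μ ω = 0 := by simpa [PMF.mem_support_iff] using hω
            simp [this]
        · simp [hc]

/-! ### The joint law -/

theorem PMF_bind_apply_le {α β : Type*} (p : PMF α) (f : α → PMF β) (b : β) (c : ℝ≥0∞)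
    (h : ∀ a ∈ p.support, f a b ≤ c) : p.bind f b ≤ c := by
  rw [PMF.bind_apply]
  calc ∑' a, p a * f a b ≤ ∑' a, p a * c := by
        refine ENNReal.tsum_le_tsum fun a => ?_
        by_cases ha : a ∈ p.support
        · exact mul_le_mul_right (h a ha) _
        · have : p a = 0 := by simpa [PMF.mem_support_iff] using ha
          simp [this]
    _ = c := by rw [ENNReal.tsum_mul_right, PMF.tsum_coe, one_mul]

theorem map_uniform_apply_le {α β : Type*} [Fintype α] [Nonempty α] (f : α → β) (b : β) (m M : ℕ)
    (hm : m * M ≤ Fintype.card α) (hM : 1 ≤ M)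
    (h : Nat.card {a // f a = b} ≤ m) :
    (PMF.uniformOfFintype α).map f b ≤ (M : ℝ≥0∞)⁻¹ := by
  classical
  rw [PMF.map_apply, tsum_fintype]
  simp only [PMF.uniformOfFintype_apply]
  rw [← Finset.sum_filter, Finset.sum_const, nsmul_eq_mul]
  have hcard : (Finset.univ.filter fun a => b = f a).card ≤ m := by
    refine le_trans (le_of_eq ?_) h
    rw [Nat.card_eq_fintype_card, Fintype.card_subtype]
    congr 1; ext a; simp [eq_comm]
  have hM0 : (M : ℝ≥0∞) ≠ 0 := by simp; omega
  rw [← div_eq_mul_inv]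
  apply ENNReal.div_le_of_le_mul
  rw [← ENNReal.div_eq_inv_mul, ENNReal.le_div_iff_mul_le (Or.inl hM0) (Or.inl (by simp))]
  exact_mod_cast (Nat.mul_le_mul_right M hcard).trans hm

namespace Scheme

variable {F E : Type u} [Field F] [Fintype F] [Field E] [Fintype E] [Algebra F E] {K D L : ℕ}

theorem mem_support_law (P : Scheme F E K D L) (hDK : D ≤ K) (hV : Nonempty (MDSMatrix F L D))
    (ω : Outcome F E K D L P.Query) :
    ω ∈ (P.law hDK hV).support ↔ ω.Q ∈ (P.query ω.W ω.V).support := by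
  unfold law
  simp only [PMF.mem_support_bind_iff, PMF.support_uniformOfFintype, PMF.mem_support_map_iff,
    Set.mem_univ, Set.top_eq_univ, true_and]
  constructor
  · rintro ⟨W, V, X, Q, hQ, rfl⟩; exact hQ
  · intro h; exact ⟨ω.W, ω.V, ω.X, ω.Q, h, rfl⟩

theorem recoverable_iff (P : Scheme F E K D L) (hDK : D ≤ K) (hV : Nonempty (MDSMatrix F L D)) :
    P.Recoverable hDK hV ↔ ∀ W V, ∀ Q ∈ (P.query W V).support, ∀ X X',
      P.answer Q X = P.answer Q X' → demand W V X = demand W V X' := by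
  unfold Recoverable
  rw [condEntropy_eq_zero_iff]
  simp only [mem_support_law]
  constructor
  · intro h W V Q hQ X X' hA
    exact h ⟨W, V, X, Q⟩ hQ ⟨W, V, X', Q⟩ hQ (by simp [A, hA])
  · rintro h ⟨W, V, X, Q⟩ hQ ⟨W', V', X', Q'⟩ - he
    simp only [A, Prod.mk.injEq] at he
    obtain ⟨hA, rfl, rfl, rfl⟩ := he
    exact h W V Q hQ X X' hA

/-- Given `(W, V)` the messages are independent of the query, so the two draws can be exchanged and
the law of the answer is a mixture, over queries, of images of the uniform law on messages. -/
theorem map_answer_apply_le (P : Scheme F E K D L) (hDK : D ≤ K)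
    (hV : Nonempty (MDSMatrix F L D)) (a : P.Answer) (c : ℝ≥0∞)
    (h : ∀ W V, ∀ Q ∈ (P.query W V).support,
      (PMF.uniformOfFintype (Fin K → E)).map (P.answer Q) a ≤ c) :
    (P.law hDK hV).map P.A a ≤ c := by
  unfold law
  rw [PMF.map_bind]
  refine PMF_bind_apply_le _ _ _ _ fun W _ => ?_
  rw [PMF.map_bind]
  refine PMF_bind_apply_le _ _ _ _ fun V _ => ?_
  rw [PMF.map_bind]
  have : ((PMF.uniformOfFintype (Fin K → E)).bind fun X =>
      PMF.map P.A (PMF.map (fun Q => (⟨W, V, X, Q⟩ : Outcome F E K D L P.Query)) (P.query W V))) =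
      (P.query W V).bind fun Q => (PMF.uniformOfFintype (Fin K → E)).map (P.answer Q) := by
    simp only [PMF.map_comp]
    unfold PMF.map
    exact PMF.bind_comm _ _ _
  rw [this]
  exact PMF_bind_apply_le _ _ _ _ fun Q hQ => h W V Q hQ

theorem map_demand_apply_le (P : Scheme F E K D L) (hDK : D ≤ K)
    (hV : Nonempty (MDSMatrix F L D)) (z : Fin L → E) (c : ℝ≥0∞)
    (h : ∀ (W : Support K D) (V : MDSMatrix F L D),
      (PMF.uniformOfFintype (Fin K → E)).map (demand W V) z ≤ c) :
    (P.law hDK hV).map P.Z z ≤ c := by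
  unfold law
  rw [PMF.map_bind]
  refine PMF_bind_apply_le _ _ _ _ fun W _ => ?_
  rw [PMF.map_bind]
  refine PMF_bind_apply_le _ _ _ _ fun V _ => ?_
  rw [PMF.map_bind]
  have : ((PMF.uniformOfFintype (Fin K → E)).bind fun X =>
      PMF.map P.Z (PMF.map (fun Q => (⟨W, V, X, Q⟩ : Outcome F E K D L P.Query)) (P.query W V))) =
      (P.query W V).bind fun Q => (PMF.uniformOfFintype (Fin K → E)).map (demand W V) := by
    simp only [PMF.map_comp]
    unfold PMF.map
    exact PMF.bind_comm _ _ _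
  rw [this]
  exact PMF_bind_apply_le _ _ _ _ fun Q hQ => h W V

theorem prob_law (P : Scheme F E K D L) (hDK : D ≤ K) (hV : Nonempty (MDSMatrix F L D))
    (s : Support K D → Prop) (q : P.Query) [DecidablePred s] :
    prob (P.law hDK hV) ({ω | s ω.W} ∩ {ω | ω.Q = q}) =
      (Fintype.card (Support K D) : ℝ≥0∞)⁻¹ * (Fintype.card (MDSMatrix F L D) : ℝ≥0∞)⁻¹ *
        ∑ W, ∑ V, if s W then P.query W V q else 0 := by
  classical
  have : Nonempty (Support K D) := Support.nonempty hDK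
  have h1 : prob (P.law hDK hV) ({ω | s ω.W} ∩ {ω | ω.Q = q}) =
      ((P.law hDK hV).map fun ω => (s ω.W, ω.Q)) (True, q) := by
    unfold prob
    rw [← PMF.toOuterMeasure_apply_singleton, PMF.toOuterMeasure_map_apply]
    congr 1
    ext ω; simp
  rw [h1]
  unfold law
  rw [PMF.map_bind, PMF.bind_apply, tsum_fintype, mul_assoc, Finset.mul_sum, Finset.mul_sum]
  refine Finset.sum_congr rfl fun W _ => ?_
  rw [PMF.uniformOfFintype_apply, PMF.map_bind, PMF.bind_apply, tsum_fintype]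
  congr 1
  rw [Finset.mul_sum]
  refine Finset.sum_congr rfl fun V _ => ?_
  rw [PMF.uniformOfFintype_apply, PMF.map_bind]
  congr 1
  simp only [PMF.map_comp, Function.comp_def]
  rw [PMF.bind_const, PMF.map_apply]
  by_cases hs : s W
  · simp only [hs, if_true, Prod.mk.injEq, true_and]
    rw [tsum_eq_single q]
    · simp
    · intro b hb; simp [hb.symm]
  · simp [hs]

end Scheme

/-! ### Arcs: families of vectors of which every `k` are linearly independent -/

/-- Among the vectors `x i` in `F ^ k` with `i ∈ A`, every `k` are linearly independent. -/
def ArcOn {F ι : Type*} [Field F] [Fintype ι] {k : ℕ} (A : Finset ι) (x : ι → Fin k → F) : Prop :=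
  ∀ c : ι → F, (∀ i ∉ A, c i = 0) → (Function.support c).ncard ≤ k → ∑ i, c i • x i = 0 → c = 0

section Arc

variable {F : Type*} [Field F] {ι : Type*} [Fintype ι] {k : ℕ}

theorem exists_vecMul_eq_zero_of_dependent {E : Type*} [Field E] [Algebra F E]
    (x : ι → Fin k → F) (I : Finset ι) (hI : I.card = k)
    (h : ∃ c : ι → E, c ≠ 0 ∧ (∀ i ∉ I, c i = 0) ∧ ∀ l, ∑ i, c i * algebraMap F E (x i l) = 0) :
    ∃ u : Fin k → F, u ≠ 0 ∧ ∀ i ∈ I, ∑ l, u l * x i l = 0 := by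
  classical
  obtain ⟨c, hc, hcI, hsum⟩ := h
  have e : Fin k ≃ I := (Finset.equivFinOfCardEq hI).symm
  let M : Matrix (Fin k) (Fin k) F := Matrix.of fun l j => x (e j) l
  have hdetE : (M.map (algebraMap F E)).det = 0 := by
    rw [← Matrix.exists_mulVec_eq_zero_iff]
    refine ⟨fun j => c (e j), ?_, ?_⟩
    · intro h0
      apply hc
      funext i
      by_cases hi : i ∈ I
      · have := congrFun h0 (e.symm ⟨i, hi⟩)
        simpa using this
      · exact hcI i hi
    · funext l
      rw [Matrix.mulVec, dotProduct, Pi.zero_apply, ← hsum l]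
      rw [Fintype.sum_equiv e _ (fun i : I => c i * algebraMap F E (x i l))
        (fun j => by simp [M, mul_comm])]
      rw [Finset.univ_eq_attach, Finset.sum_attach I fun i => c i * algebraMap F E (x i l)]
      exact Finset.sum_subset (Finset.subset_univ I) fun i _ hi => by simp [hcI i hi]
  -- The determinant has entries in `F`, so its vanishing descends from `E` to `F`.
  have hdet : M.det = 0 := by
    have := RingHom.map_det (algebraMap F E) M
    rw [RingHom.mapMatrix_apply, hdetE] at this
    exact (map_eq_zero_iff _ (algebraMap F E).injective).1 this
  obtain ⟨u, hu, huM⟩ := Matrix.exists_vecMul_eq_zero_iff.2 hdet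
  refine ⟨u, hu, fun i hi => ?_⟩
  have := congrFun huM (e.symm ⟨i, hi⟩)
  simpa [Matrix.vecMul, dotProduct, M] using this

theorem exists_dependent_of_vecMul_eq_zero
    (x : ι → Fin k → F) (I : Finset ι) (hI : I.card = k)
    (h : ∃ u : Fin k → F, u ≠ 0 ∧ ∀ i ∈ I, ∑ l, u l * x i l = 0) :
    ∃ c : ι → F, c ≠ 0 ∧ (∀ i ∉ I, c i = 0) ∧ ∑ i, c i • x i = 0 := by
  classical
  obtain ⟨u, hu, huI⟩ := h
  have e : Fin k ≃ I := (Finset.equivFinOfCardEq hI).symm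
  let M : Matrix (Fin k) (Fin k) F := Matrix.of fun l j => x (e j) l
  have hdet : M.det = 0 := by
    rw [← Matrix.exists_vecMul_eq_zero_iff]
    refine ⟨u, hu, ?_⟩
    funext j
    simpa [Matrix.vecMul, dotProduct, M] using huI (e j) (e j).2
  obtain ⟨v, hv, hvM⟩ := Matrix.exists_mulVec_eq_zero_iff.2 hdet
  refine ⟨fun i => if hi : i ∈ I then v (e.symm ⟨i, hi⟩) else 0, ?_, ?_, ?_⟩
  · intro h0
    apply hv
    funext j
    have := congrFun h0 (e j)
    simpa using this
  · intro i hi; simp [hi]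
  · funext l
    have := congrFun hvM l
    rw [Matrix.mulVec, dotProduct] at this
    rw [Finset.sum_apply, ← this]
    rw [Fintype.sum_equiv e _ (fun i : I => v (e.symm i) * x i l)
        (fun j => by simp [M, mul_comm])]
    rw [Finset.univ_eq_attach]
    symm
    rw [← Finset.sum_subset (Finset.subset_univ I) fun i _ hi => by simp [hi]]
    refine Eq.trans ?_ (Finset.sum_attach I _)
    exact Finset.sum_congr rfl fun i _ => by simp

theorem ArcOn.congr {A : Finset ι} {x y : ι → Fin k → F} (h : ∀ i ∈ A, x i = y i)
    (hx : ArcOn A x) : ArcOn A y := by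
  intro c hc hk hs
  refine hx c hc hk ?_
  rw [← hs]
  refine Finset.sum_congr rfl fun i _ => ?_
  by_cases hi : i ∈ A
  · rw [h i hi]
  · simp [hc i hi]

theorem ArcOn.mono {A B : Finset ι} (hAB : A ⊆ B) {x : ι → Fin k → F} (h : ArcOn B x) :
    ArcOn A x := fun c hc hk hs => h c (fun i hi => hc i fun hA => hi (hAB hA)) hk hs

theorem arcOn_comp_iff {κ : Type*} [Fintype κ] (e : κ ↪ ι) (x : ι → Fin k → F) :
    ArcOn Finset.univ (x ∘ e) ↔ ArcOn (Finset.univ.map e) x := by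
  classical
  constructor
  · intro h c hc hk hs
    have h1 : c ∘ e = 0 := by
      refine h (c ∘ e) (by simp) ?_ ?_
      · refine le_trans ?_ hk
        have : e '' Function.support (c ∘ e) ⊆ Function.support c := by
          rintro _ ⟨i, hi, rfl⟩; exact hi
        rw [← Set.ncard_image_of_injective _ e.injective]
        exact Set.ncard_le_ncard this
      · rw [← hs]
        rw [← Finset.sum_subset (Finset.subset_univ (Finset.univ.map e))
          fun i _ hi => by simp [hc i hi]]
        simp
    funext i
    by_cases hi : i ∈ Finset.univ.map e
    · obtain ⟨j, -, rfl⟩ := Finset.mem_map.1 hi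
      exact congrFun h1 j
    · exact hc i hi
  · intro h c _ hk hs
    have hext : ∀ j, Function.extend e c 0 (e j) = c j := fun j => e.injective.extend_apply _ _ j
    have hout : ∀ i ∉ Finset.univ.map e, Function.extend e c 0 i = 0 := by
      intro i hi
      rw [Function.extend_apply']
      · rfl
      · rintro ⟨j, rfl⟩; exact hi (by simp)
    have h1 : Function.extend e c 0 = 0 := by
      refine h _ hout ?_ ?_
      · refine le_trans ?_ hk
        rw [← Set.ncard_image_of_injective _ e.injective]
        refine Set.ncard_le_ncard ?_
        intro i hi
        by_cases hi' : i ∈ Finset.univ.map e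
        · obtain ⟨j, -, rfl⟩ := Finset.mem_map.1 hi'
          refine ⟨j, ?_, rfl⟩
          simpa [hext] using hi
        · exact absurd (hout i hi') hi
      · rw [← Finset.sum_subset (Finset.subset_univ (Finset.univ.map e))
          fun i _ hi => by simp [hout i hi]]
        simp only [Finset.sum_map, hext]
        exact hs
    funext j
    rw [← hext j, h1]; rfl

theorem ArcOn.comp {κ : Type*} [Fintype κ] (e : κ ↪ ι) {x : ι → Fin k → F}
    (h : ArcOn Finset.univ x) : ArcOn Finset.univ (x ∘ e) :=
  (arcOn_comp_iff e x).2 (h.mono (Finset.subset_univ _))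

theorem ArcOn.smul {A : Finset ι} {x : ι → Fin k → F} (h : ArcOn A x) (a : ι → F)
    (ha : ∀ i, a i ≠ 0) : ArcOn A fun i => a i • x i := by
  intro c hc hk hs
  have h1 : (fun i => c i * a i) = 0 := by
    refine h _ (fun i hi => by simp [hc i hi]) ?_ ?_
    · refine le_trans (Set.ncard_le_ncard ?_) hk
      intro i hi
      simp only [Function.mem_support] at hi ⊢
      exact left_ne_zero_of_mul hi
    · rw [← hs]
      exact Finset.sum_congr rfl fun i _ => by rw [smul_smul]
  funext i
  exact (mul_eq_zero.1 (congrFun h1 i)).resolve_right (ha i)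

theorem ArcOn.eq_zero_of_vecMul {x : ι → Fin k → F} (h : ArcOn Finset.univ x) (I : Finset ι)
    (hI : k ≤ I.card) (u : Fin k → F) (hu : ∀ i ∈ I, ∑ l, u l * x i l = 0) : u = 0 := by
  by_contra hne
  obtain ⟨J, hJI, hJ⟩ := Finset.exists_subset_card_eq hI
  obtain ⟨c, hc, hcJ, hs⟩ := exists_dependent_of_vecMul_eq_zero x J hJ
    ⟨u, hne, fun i hi => hu i (hJI hi)⟩
  refine hc (h c (by simp) ?_ hs)
  have : Function.support c ⊆ J := by
    intro i hi
    by_contra hi'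
    exact hi (hcJ i hi')
  calc (Function.support c).ncard ≤ (J : Set ι).ncard := Set.ncard_le_ncard this
    _ = k := by rw [Set.ncard_coe_finset, hJ]

/-- The coefficients are allowed in an extension `E`, because the messages live there while the
coding matrices are over `F`. -/
theorem ArcOn.of_vecMul (hk : k ≤ Fintype.card ι) {x : ι → Fin k → F}
    (h : ∀ I : Finset ι, I.card = k → ∀ u : Fin k → F, (∀ i ∈ I, ∑ l, u l * x i l = 0) → u = 0)
    {E : Type*} [Field E] [Algebra F E] (c : ι → E)
    (hc : (Function.support c).ncard ≤ k) (hs : ∀ l, ∑ i, c i * algebraMap F E (x i l) = 0) :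
    c = 0 := by
  classical
  by_contra hne
  have hc' : (Function.support c).toFinset.card ≤ k := by
    rwa [Set.ncard_eq_toFinset_card'] at hc
  obtain ⟨I, hI1, hI⟩ := Finset.exists_superset_card_eq hc' hk
  obtain ⟨u, hu, hu'⟩ := exists_vecMul_eq_zero_of_dependent (E := E) x I hI ⟨c, hne, fun i hi => by
    by_contra h0
    exact hi (hI1 (by simpa using h0)), hs⟩
  exact hu (h I hI u hu')

theorem arcOn_univ_iff (hk : k ≤ Fintype.card ι) {x : ι → Fin k → F} : ArcOn Finset.univ x ↔
    ∀ I : Finset ι, I.card = k → ∀ u : Fin k → F, (∀ i ∈ I, ∑ l, u l * x i l = 0) → u = 0 := by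
  constructor
  · intro h I hI u hu
    exact h.eq_zero_of_vecMul I hI.ge u hu
  · intro h c _ hc hs
    refine ArcOn.of_vecMul (E := F) hk h c hc fun l => ?_
    have := congrFun hs l
    simpa using this

/-- If the rows of `x` and of `y` are bases of mutually orthogonal subspaces of complementary
dimensions, then `y` is an arc if `x` is. -/
theorem ArcOn.dual {a b : ℕ} (hab : a + b = Fintype.card ι) {x : ι → Fin a → F}
    {y : ι → Fin b → F} (hx : ArcOn Finset.univ x) (hxy : ∀ l m, ∑ i, x i l * y i m = 0)
    (hy : ∀ u : Fin b → F, (∀ i, ∑ m, u m * y i m = 0) → u = 0) : ArcOn Finset.univ y := by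
  classical
  rw [arcOn_univ_iff (by omega)]
  intro I hI u hu
  apply hy
  intro i
  -- This word vanishes on the `b` positions of `I`, so it is a linear relation among at most `a` of
  -- the vectors `x i`.
  have : (fun i => ∑ m, u m * y i m) = 0 := by
    refine hx _ (by simp) ?_ ?_
    · have hsub : Function.support (fun i => ∑ m, u m * y i m) ⊆ (Iᶜ : Finset ι) := by
        intro i hi
        simp only [Finset.coe_compl, Set.mem_compl_iff, Finset.mem_coe]
        exact fun hiI => hi (hu i hiI)
      calc _ ≤ ((Iᶜ : Finset ι) : Set ι).ncard := Set.ncard_le_ncard hsub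
        _ = a := by rw [Set.ncard_coe_finset, Finset.card_compl]; omega
    · funext l
      simp only [Finset.sum_apply, Pi.smul_apply, smul_eq_mul, Finset.sum_mul, Pi.zero_apply]
      rw [Finset.sum_comm]
      refine Finset.sum_eq_zero fun m _ => ?_
      have := hxy l m
      calc ∑ i, u m * y i m * x i l = u m * ∑ i, x i l * y i m := by
            rw [Finset.mul_sum]; exact Finset.sum_congr rfl fun i _ => by ring
        _ = 0 := by rw [this, mul_zero]
  exact congrFun this i

theorem ArcOn.range_eq_top {x : ι → Fin k → F} (h : ArcOn Finset.univ x)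
    (hk : k ≤ Fintype.card ι) : LinearMap.range (Fintype.linearCombination F x) = ⊤ := by
  classical
  by_contra hne
  obtain ⟨f, hf, hle⟩ := Submodule.exists_le_ker_of_lt_top _ (lt_top_iff_ne_top.2 hne)
  have hu : (fun l => f (Pi.single l 1)) = 0 := by
    refine h.eq_zero_of_vecMul Finset.univ (by simpa using hk) _ fun i _ => ?_
    have h1 : f (x i) = 0 := by
      have : x i ∈ LinearMap.range (Fintype.linearCombination F x) :=
        ⟨Pi.single i 1, by simp⟩
      exact hle this
    rw [pi_eq_sum_univ' (x i), map_sum] at h1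
    rw [← h1]
    refine Finset.sum_congr rfl fun l _ => ?_
    rw [map_smul, smul_eq_mul, mul_comm]
  apply hf
  refine LinearMap.pi_ext' fun l => LinearMap.ext_ring ?_
  simpa using congrFun hu l

theorem ArcOn.finrank_ker {x : ι → Fin k → F} (h : ArcOn Finset.univ x)
    (hk : k ≤ Fintype.card ι) :
    Module.finrank F (LinearMap.ker (Fintype.linearCombination F x)) = Fintype.card ι - k := by
  have h1 := LinearMap.finrank_range_add_finrank_ker (Fintype.linearCombination F x)
  rw [h.range_eq_top hk, finrank_top, Module.finrank_fintype_fun_eq_card,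
    Module.finrank_fintype_fun_eq_card, Fintype.card_fin] at h1
  omega

/-- The number of arcs dual to a given one depends on the parameters only. -/
theorem card_dual [Fintype F] {a b : ℕ} (hab : a + b = Fintype.card ι) {x : ι → Fin a → F}
    (hx : ArcOn Finset.univ x) :
    Nat.card {y : ι → Fin b → F // ArcOn Finset.univ y ∧ ∀ l m, ∑ i, x i l * y i m = 0} =
      ∏ i : Fin b, (Fintype.card F ^ b - Fintype.card F ^ (i : ℕ)) := by
  classical
  have hker := hx.finrank_ker (by omega)
  have hb : Module.finrank F (LinearMap.ker (Fintype.linearCombination F x)) = b := by omega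
  have hcard := card_linearIndependent (K := F)
    (V := LinearMap.ker (Fintype.linearCombination F x)) (k := b) hb.ge
  rw [hb] at hcard
  rw [← hcard]
  have hli : ∀ y : ι → Fin b → F, LinearIndependent F (fun m i => y i m) ↔
      ∀ u : Fin b → F, (∀ i, ∑ m, u m * y i m = 0) → u = 0 := by
    intro y
    rw [Fintype.linearIndependent_iff]
    refine forall_congr' fun u => ?_
    rw [funext_iff, funext_iff]
    simp [Finset.sum_apply]
  have hmem : ∀ (s : {s : Fin b → LinearMap.ker (Fintype.linearCombination F x) //
      LinearIndependent F s}) (l : Fin a) (m : Fin b), ∑ i, x i l * (s.1 m : ι → F) i = 0 := by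
    intro s l m
    have := congrFun (LinearMap.mem_ker.1 (s.1 m).2) l
    rw [Fintype.linearCombination_apply, Finset.sum_apply, Pi.zero_apply] at this
    rw [← this]
    exact Finset.sum_congr rfl fun i _ => mul_comm _ _
  -- Dual arcs are the ordered bases of the kernel of the linear combination map of `x`; the arc
  -- property of such a basis is automatic by `ArcOn.dual`.
  refine Nat.card_congr ⟨fun y => ⟨fun m => ⟨fun i => y.1 i m, ?_⟩, ?_⟩,
    fun s => ⟨fun i m => (s.1 m : ι → F) i, ?_, ?_⟩, ?_, ?_⟩
  · rw [LinearMap.mem_ker, Fintype.linearCombination_apply]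
    funext l
    have := y.2.2 l m
    simpa [Finset.sum_apply, mul_comm] using this
  · rw [← LinearMap.linearIndependent_iff_of_injOn
      (LinearMap.ker (Fintype.linearCombination F x)).subtype
      (Subtype.val_injective.injOn)]
    exact (hli y.1).2 fun u hu => y.2.1.eq_zero_of_vecMul Finset.univ
      (by simp; omega) u fun i _ => hu i
  · refine hx.dual hab ?_ ((hli _).1 ?_)
    · intro l m
      exact hmem s l m
    · exact s.2.map' (LinearMap.ker (Fintype.linearCombination F x)).subtype
        (Submodule.ker_subtype _)
  · intro l m
    exact hmem s l m
  · intro y; rfl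
  · intro s; rfl

end Arc

/-! ### MDS generator matrices as arcs of columns -/

section MDS

variable {F : Type*} [Field F] {L D : ℕ}

/-- Minimum distance at least `D - L + 1` means that no nonzero codeword vanishes at `L` positions,
that is, no nonzero functional kills `L` of the columns. -/
theorem generatesMDS_iff (hLD : L ≤ D) (V : Matrix (Fin L) (Fin D) F) :
    GeneratesMDS V ↔ ArcOn Finset.univ fun j l => V l j := by
  classical
  rw [arcOn_univ_iff (by simpa using hLD)]
  have hham : ∀ c : Fin D → F, hammingNorm c + (Finset.univ.filter fun j => c j = 0).card = D := by
    intro c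
    have := Finset.card_filter_add_card_filter_not (s := (Finset.univ : Finset (Fin D)))
      (fun j => c j = 0)
    rw [Finset.card_univ, Fintype.card_fin] at this
    rw [hammingNorm, add_comm]
    convert this
  have hsum : ∀ u : Fin L → F, ∀ j, (∑ l, u l • V.row l) j = ∑ l, u l * V l j := by
    intro u j; simp [Finset.sum_apply, Matrix.row]
  constructor
  · rintro ⟨hli, hmds⟩ I hI u hu
    by_contra hne
    have hmem : ∑ l, u l • V.row l ∈ Submodule.span F (Set.range V.row) :=
      Submodule.sum_mem _ fun l _ => Submodule.smul_mem _ _ (Submodule.subset_span ⟨l, rfl⟩)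
    have hne' : ∑ l, u l • V.row l ≠ 0 := fun h0 =>
      hne (funext (Fintype.linearIndependent_iff.1 hli u h0))
    have h1 := hmds _ hmem hne'
    rw [finrank_span_eq_card hli, Fintype.card_fin] at h1
    have h2 := hham (∑ l, u l • V.row l)
    have h3 : I.card ≤ (Finset.univ.filter fun j => (∑ l, u l • V.row l) j = 0).card := by
      refine Finset.card_le_card fun j hj => ?_
      rw [Finset.mem_filter]
      exact ⟨Finset.mem_univ j, (hsum u j).trans (hu j hj)⟩
    have h4 : hammingNorm (∑ l, u l • V.row l) + L ≥ D + 1 := by convert h1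
    omega
  · intro h
    have hz : ∀ u : Fin L → F, u ≠ 0 →
        (Finset.univ.filter fun j => (∑ l, u l • V.row l) j = 0).card < L := by
      intro u hu
      by_contra hge
      push Not at hge
      obtain ⟨J, hJI, hJ⟩ := Finset.exists_subset_card_eq hge
      refine hu (h J hJ u fun i hi => ?_)
      rw [← hsum]
      exact (Finset.mem_filter.1 (hJI hi)).2
    have hli : LinearIndependent F V.row := by
      rw [Fintype.linearIndependent_iff]
      intro u hu
      by_contra hne
      have hne' : u ≠ 0 := fun h0 => hne fun i => by rw [h0]; rfl
      have := hz u hne'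
      rw [hu] at this
      simp at this
      omega
    refine ⟨hli, ?_⟩
    intro c hc hne
    rw [finrank_span_eq_card hli, Fintype.card_fin]
    obtain ⟨u, rfl⟩ := (Submodule.mem_span_range_iff_exists_fun F).1 hc
    have hu : u ≠ 0 := by rintro rfl; simp at hne
    have h1 := hz u hu
    have h2 := hham (∑ l, u l • V.row l)
    have h4 : hammingNorm (∑ l, u l • V.row l) + L ≥ D + 1 := by omega
    convert h4

theorem GeneratesMDS.eq_zero_of_mulVec {E : Type*} [Field E] [Algebra F E] (hLD : L ≤ D)
    {V : Matrix (Fin L) (Fin D) F} (hV : GeneratesMDS V) (c : Fin D → E)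
    (hc : (Function.support c).ncard ≤ L) (h : (V.map (algebraMap F E)).mulVec c = 0) : c = 0 := by
  have hk : L ≤ Fintype.card (Fin D) := by simpa using hLD
  refine ArcOn.of_vecMul hk ((arcOn_univ_iff hk).1 ((generatesMDS_iff hLD V).1 hV)) c hc fun l => ?_
  have := congrFun h l
  simpa [Matrix.mulVec, dotProduct, mul_comm] using this

end MDS

/-! ### The upper bound on the capacity -/

/-- Within a fibre of `f` a vector is determined by its coordinates outside `T`. -/
theorem card_fiber_le {E β : Type*} [Fintype E] {K : ℕ} (f : (Fin K → E) → β) (T : Finset (Fin K))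
    (h : ∀ X X', f X = f X' → (∀ i ∉ T, X i = X' i) → X = X') (b : β) :
    Nat.card {X // f X = b} ≤ Fintype.card E ^ (K - T.card) := by
  classical
  have h1 : Nat.card ({i // i ∉ T} → E) = Fintype.card E ^ (K - T.card) := by
    rw [Nat.card_eq_fintype_card, Fintype.card_fun, Fintype.card_subtype_compl,
      Fintype.card_fin, Fintype.card_coe]
  rw [← h1]
  refine Nat.card_le_card_of_injective (fun X i => X.1 i) ?_
  rintro ⟨X, hX⟩ ⟨X', hX'⟩ he
  exact Subtype.ext (h X X' (hX.trans hX'.symm) fun i hi => congrFun he ⟨i, hi⟩)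

theorem map_uniform_apply_le_of_determined {E β : Type*} [Fintype E] [Nonempty E] {K r : ℕ}
    (f : (Fin K → E) → β) (T : Finset (Fin K)) (hr : r ≤ T.card)
    (h : ∀ X X', f X = f X' → (∀ i ∉ T, X i = X' i) → X = X') (b : β) :
    (PMF.uniformOfFintype (Fin K → E)).map f b ≤ ((Fintype.card E ^ r : ℕ) : ℝ≥0∞)⁻¹ := by
  have hT : T.card ≤ K := by simpa using Finset.card_le_univ T
  refine map_uniform_apply_le f b (Fintype.card E ^ (K - T.card)) _ ?_
    (Nat.one_le_pow _ _ Fintype.card_pos) (card_fiber_le f T h b)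
  rw [Fintype.card_fun, Fintype.card_fin, ← pow_add]
  exact Nat.pow_le_pow_right Fintype.card_pos (by omega)

/-! ### Independent symbols forced by a covering family of demands -/

section Demand

variable {F E : Type*} [Field F] [Field E] [Algebra F E] {K D L : ℕ}

theorem demand_sub (W : Support K D) (V : MDSMatrix F L D) (X X' : Fin K → E) :
    demand W V (X - X') = demand W V X - demand W V X' := by
  unfold demand
  rw [← Matrix.mulVec_sub]
  rfl

/-- On `W` the vector `Y` has at most `L` nonzero entries, and any `L` columns of `V` are
independent, also over `E`. -/
theorem eq_zero_on_of_demand_eq_zero (hLD : L ≤ D) (W : Support K D) (V : MDSMatrix F L D)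
    (Y : Fin K → E) (T : Finset (Fin K)) (hT : T.card ≤ L) (h0 : ∀ i ∈ W.1, i ∉ T → Y i = 0)
    (h : demand W V Y = 0) : ∀ i ∈ W.1, Y i = 0 := by
  have hc : (fun j => Y (W.1.orderEmbOfFin W.2 j)) = 0 := by
    refine V.2.eq_zero_of_mulVec hLD _ ?_ h
    refine le_trans ?_ hT
    rw [← Set.ncard_coe_finset T, ← Set.ncard_image_of_injective _ (W.1.orderEmbOfFin W.2).injective]
    refine Set.ncard_le_ncard ?_
    rintro _ ⟨j, hj, rfl⟩
    by_contra hnT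
    exact hj (h0 _ (Finset.orderEmbOfFin_mem _ _ _) hnT)
  intro i hi
  have : i ∈ Set.range (W.1.orderEmbOfFin W.2) := by rwa [Finset.range_orderEmbOfFin]
  obtain ⟨j, rfl⟩ := this
  exact congrFun hc j

/-- The induction step for counting symbols when `k` new indices join `n` old ones. Without a carry
it is subadditivity of `min L`. With a carry, `min L` is concave, so replacing the pair `n % D`, `k`
by the more spread out pair `D`, `n % D + k - D` of equal sum does not increase the total. -/
theorem coverage_step {D L : ℕ} (hL : 1 ≤ L) (hLD : L ≤ D) (n k : ℕ) (hk : k ≤ D) :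
    L * ((n + k) / D) + min L ((n + k) % D) ≤ L * (n / D) + min L (n % D) + min L k := by
  have hD : 0 < D := by omega
  have hm := Nat.mod_lt n hD
  have hn := Nat.div_add_mod n D
  rcases lt_or_ge (n % D + k) D with h | h
  · have h3 : (n + k) = (n % D + k) + D * (n / D) := by omega
    have h1 : (n + k) / D = n / D := by
      rw [h3, Nat.add_mul_div_left _ _ hD, Nat.div_eq_of_lt h, zero_add]
    have h2 : (n + k) % D = n % D + k := by
      rw [h3, Nat.add_mul_mod_self_left, Nat.mod_eq_of_lt h]
    rw [h1, h2]; omega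
  · have hkD : n % D + k - D < D := by omega
    have h3 : (n + k) = (n % D + k - D) + D * (n / D + 1) := by rw [mul_add]; omega
    have h1 : (n + k) / D = n / D + 1 := by
      rw [h3, Nat.add_mul_div_left _ _ hD, Nat.div_eq_of_lt hkD, zero_add]
    have h2 : (n + k) % D = n % D + k - D := by
      rw [h3, Nat.add_mul_mod_self_left, Nat.mod_eq_of_lt hkD]
    rw [h1, h2, mul_add]; omega

/-- If every message index is covered by one of the demands in `C`, then these demands together
involve at least `L * (K / D) + min L (K % D)` independent symbols. -/
theorem exists_determined (hL : 1 ≤ L) (hLD : L ≤ D) (C : Support K D → MDSMatrix F L D → Prop)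
    (hC : ∀ i, ∃ W V, C W V ∧ i ∈ W.1) :
    ∃ T : Finset (Fin K), L * (K / D) + min L (K % D) ≤ T.card ∧
      ∀ Y : Fin K → E, (∀ W V, C W V → demand W V Y = 0) → (∀ i ∉ T, Y i = 0) → Y = 0 := by
  classical
  -- A set `U` is good if the claim holds with `U` in place of all indices. A good set of maximal
  -- size is everything, since adjoining a support that meets its complement preserves goodness.
  let good : Finset (Fin K) → Prop := fun U => ∃ T ⊆ U,
    L * (U.card / D) + min L (U.card % D) ≤ T.card ∧
      ∀ Y : Fin K → E, (∀ W V, C W V → demand W V Y = 0) → (∀ i ∈ U, i ∉ T → Y i = 0) →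
        ∀ i ∈ U, Y i = 0
  have hempty : good ∅ := ⟨∅, le_rfl, by simp, by simp⟩
  obtain ⟨U, hU, hmax⟩ := Finset.exists_max_image (Finset.univ.filter good) Finset.card
    ⟨∅, by simpa using hempty⟩
  have hUgood : good U := (Finset.mem_filter.1 hU).2
  have hUuniv : U = Finset.univ := by
    by_contra hne
    obtain ⟨i, hi⟩ : ∃ i, i ∉ U := by
      by_contra hall
      push Not at hall
      exact hne (Finset.eq_univ_iff_forall.2 hall)
    obtain ⟨W, V, hCWV, hiW⟩ := hC i
    obtain ⟨T, hTU, hTcard, hT⟩ := hUgood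
    -- The demand on `W` resolves up to `L` of the new indices; the rest of `W` is known from
    -- outside `T ∪ T'` or from `U`.
    obtain ⟨T', hT'sub, hT'card⟩ := Finset.exists_subset_card_eq
      (s := W.1 \ U) (n := min L (W.1 \ U).card) (min_le_right _ _)
    have hdisj : Disjoint T T' := by
      rw [Finset.disjoint_left]
      intro j hj hj'
      exact (Finset.mem_sdiff.1 (hT'sub hj')).2 (hTU hj)
    have hcardU : (U ∪ W.1).card = U.card + (W.1 \ U).card := by
      rw [← Finset.union_sdiff_self_eq_union, Finset.card_union_of_disjoint Finset.disjoint_sdiff]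
    have hkD : (W.1 \ U).card ≤ D := by
      exact (Finset.card_le_card Finset.sdiff_subset).trans W.2.le
    have hgood : good (U ∪ W.1) := by
      refine ⟨T ∪ T', ?_, ?_, ?_⟩
      · exact Finset.union_subset_union hTU (hT'sub.trans Finset.sdiff_subset)
      · rw [hcardU, Finset.card_union_of_disjoint hdisj, hT'card]
        exact (coverage_step hL hLD _ _ hkD).trans (Nat.add_le_add_right hTcard _)
      · intro Y hY h0
        have hYU : ∀ j ∈ U, Y j = 0 := by
          refine hT Y hY fun j hj hjT => h0 j (Finset.mem_union_left _ hj) ?_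
          rw [Finset.mem_union, not_or]
          exact ⟨hjT, fun hj' => (Finset.mem_sdiff.1 (hT'sub hj')).2 hj⟩
        have hYW : ∀ j ∈ W.1, Y j = 0 := by
          refine eq_zero_on_of_demand_eq_zero hLD W V Y T' (hT'card.trans_le (min_le_left _ _)) ?_
            (hY W V hCWV)
          intro j hj hjT'
          by_cases hjU : j ∈ U
          · exact hYU j hjU
          · refine h0 j (Finset.mem_union_right _ hj) ?_
            rw [Finset.mem_union, not_or]
            exact ⟨fun hjT => hjU (hTU hjT), hjT'⟩
        intro j hj
        exact (Finset.mem_union.1 hj).elim (hYU j) (hYW j)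
    have h1 := hmax (U ∪ W.1) (by simpa using hgood)
    have h2 : U.card < (U ∪ W.1).card := Finset.card_lt_card
      ⟨Finset.subset_union_left, fun h => hi (h (Finset.mem_union_right _ hiW))⟩
    omega
  subst hUuniv
  obtain ⟨T, -, hTcard, hT⟩ := hUgood
  rw [Finset.card_univ, Fintype.card_fin] at hTcard
  exact ⟨T, hTcard, fun Y hY h0 => funext fun i => hT Y hY (fun j _ hj => h0 j hj) i (by simp)⟩

end Demand

theorem ofReal_div_le_of_entropy {a b : ℝ≥0∞} {l r : ℕ} {q : ℝ} (hq : 1 < q) (hr : 1 ≤ r)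
    (ha : a ≤ ENNReal.ofReal (Real.log (q ^ l) / Real.log 2))
    (hb : ENNReal.ofReal (Real.log (q ^ r) / Real.log 2) ≤ b) :
    a / b ≤ ENNReal.ofReal ((l : ℝ) / r) := by
  have h2 : (0 : ℝ) < Real.log 2 := Real.log_pos (by norm_num)
  have hlq := Real.log_pos hq
  have hr' : (0 : ℝ) < r := by exact_mod_cast hr
  refine (ENNReal.div_le_div ha hb).trans ?_
  rw [← ENNReal.ofReal_div_of_pos (by rw [Real.log_pow]; positivity)]
  apply ENNReal.ofReal_le_ofReal
  rw [Real.log_pow, Real.log_pow]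
  apply le_of_eq
  field_simp

theorem le_div_of_entropy {a b : ℝ≥0∞} {l r : ℕ} {q : ℝ} (hq : 1 < q) (hr : 1 ≤ r)
    (ha : ENNReal.ofReal (Real.log (q ^ l) / Real.log 2) ≤ a)
    (hb : b ≤ ENNReal.ofReal (Real.log (q ^ r) / Real.log 2)) :
    ENNReal.ofReal ((l : ℝ) / r) ≤ a / b := by
  have h2 : (0 : ℝ) < Real.log 2 := Real.log_pos (by norm_num)
  have hlq := Real.log_pos hq
  have hr' : (0 : ℝ) < r := by exact_mod_cast hr
  refine le_trans ?_ (ENNReal.div_le_div ha hb)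
  rw [← ENNReal.ofReal_div_of_pos (by rw [Real.log_pow]; positivity)]
  apply ENNReal.ofReal_le_ofReal
  rw [Real.log_pow, Real.log_pow]
  apply le_of_eq
  field_simp

section Capacity

variable {F E : Type u} [Field F] [Fintype F] [Field E] [Fintype E] [Algebra F E] {K D L : ℕ}

/-- Since `1 ≤ D ≤ K`, the prior probability of `i ∈ W` is positive; privacy makes the conditional
probability given `q` positive too. -/
theorem exists_mem_support_of_private (P : Scheme F E K D L) (hD : 1 ≤ D) (hDK : D ≤ K)
    (hV : Nonempty (MDSMatrix F L D)) (hP : P.IndividuallyPrivate hDK hV)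
    (W : Support K D) (V : MDSMatrix F L D) (q : P.Query) (hq : q ∈ (P.query W V).support)
    (i : Fin K) : ∃ W' V', q ∈ (P.query W' V').support ∧ i ∈ W'.1 := by
  have : Nonempty E := ⟨0⟩
  have hne : ∀ s : Set (Outcome F E K D L P.Query),
      prob (P.law hDK hV) s ≠ 0 ↔ ∃ ω ∈ (P.law hDK hV).support, ω ∈ s := by
    intro s
    unfold prob
    rw [ne_eq, PMF.toOuterMeasure_apply_eq_zero_iff, Set.not_disjoint_iff]
  have h1 : prob (P.law hDK hV) {ω | ω.Q = q} ≠ 0 :=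
    (hne _).2 ⟨⟨W, V, 0, q⟩, (P.mem_support_law hDK hV _).2 hq, rfl⟩
  obtain ⟨W₀, hiW₀⟩ : ∃ W₀ : Support K D, i ∈ W₀.1 := by
    obtain ⟨W₀, h1, h2⟩ := Finset.exists_superset_card_eq (s := {i}) (n := D) (by simpa using hD)
      (by simpa using hDK)
    exact ⟨⟨W₀, h2⟩, h1 (by simp)⟩
  obtain ⟨q₀, hq₀⟩ := (P.query W₀ V).support_nonempty
  have h2 : prob (P.law hDK hV) {ω | i ∈ ω.W.1} ≠ 0 :=
    (hne _).2 ⟨⟨W₀, V, 0, q₀⟩, (P.mem_support_law hDK hV _).2 hq₀, hiW₀⟩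
  rw [← hP q h1 i] at h2
  have h3 : prob (P.law hDK hV) ({ω | i ∈ ω.W.1} ∩ {ω | ω.Q = q}) ≠ 0 := by
    intro h0
    rw [condProb, h0, ENNReal.zero_div] at h2
    exact h2 rfl
  obtain ⟨ω, hω, hi, hωq⟩ := (hne _).1 h3
  refine ⟨ω.W, ω.V, ?_, hi⟩
  have := (P.mem_support_law hDK hV _).1 hω
  rwa [show ω.Q = q from hωq] at this

theorem capacity_le (hL : 1 ≤ L) (hLD : L ≤ D) (hDK : D ≤ K)
    (hV : Nonempty (MDSMatrix F L D)) :
    capacity F E hDK hV ≤ ENNReal.ofReal ((L : ℝ) / (L * (K / D) + min L (K % D) : ℕ)) := by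
  unfold capacity
  refine iSup₂_le fun P hP => ?_
  have hD : 1 ≤ D := hL.trans hLD
  have hr : 1 ≤ L * (K / D) + min L (K % D) := by
    have h1 : 1 ≤ K / D := (Nat.one_le_div_iff hD).2 hDK
    have := Nat.mul_le_mul hL h1
    omega
  have hq : (1 : ℝ) < Fintype.card E := by exact_mod_cast Fintype.one_lt_card
  refine ofReal_div_le_of_entropy hq hr ?_ ?_
  · have := entropy_le_log_card (P.law hDK hV) P.Z
    rwa [Fintype.card_fun, Fintype.card_fin, Nat.cast_pow] at this
  · have := log_card_le_entropy (P.law hDK hV) P.A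
      (M := Fintype.card E ^ (L * (K / D) + min L (K % D)))
      (Nat.one_le_pow _ _ Fintype.card_pos) ?_
    · rwa [Nat.cast_pow] at this
    · intro a
      refine P.map_answer_apply_le hDK hV a _ fun W V q hqs => ?_
      -- The family consists of all demands compatible with `q`. By linearity it suffices to treat
      -- the difference of two message vectors with equal answers.
      obtain ⟨T, hTcard, hT⟩ := exists_determined (E := E) hL hLD
        (fun W' (V' : MDSMatrix F L D) => q ∈ (P.query W' V').support)
        (exists_mem_support_of_private P hD hDK hV hP.1 W V q hqs)
      refine map_uniform_apply_le_of_determined _ T hTcard (fun X X' hA hX => ?_) a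
      have := hT (X - X') (fun W' V' hC => ?_) fun i hi => sub_eq_zero.2 (hX i hi)
      · exact sub_eq_zero.1 this
      · rw [demand_sub, sub_eq_zero]
        exact (P.recoverable_iff hDK hV).1 hP.2 W' V' q hC X X' hA

/-- The demand is uniform: with all messages fixed except `L` of those in `W`, it is injective in
these `L`. -/
theorem log_card_le_entropy_demand (P : Scheme F E K D L) (hLD : L ≤ D) (hDK : D ≤ K)
    (hV : Nonempty (MDSMatrix F L D)) :
    ENNReal.ofReal (Real.log ((Fintype.card E : ℝ) ^ L) / Real.log 2) ≤
      entropy (P.law hDK hV) P.Z := by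
  have := log_card_le_entropy (P.law hDK hV) P.Z (M := Fintype.card E ^ L)
    (Nat.one_le_pow _ _ Fintype.card_pos) ?_
  · rwa [Nat.cast_pow] at this
  · intro z
    refine P.map_demand_apply_le hDK hV z _ fun W V => ?_
    obtain ⟨T, hTW, hT⟩ := Finset.exists_subset_card_eq (s := W.1) (n := L) (by rw [W.2]; exact hLD)
    refine map_uniform_apply_le_of_determined _ T hT.ge (fun X X' hA hX => ?_) z
    funext i
    by_cases hi : i ∈ T
    · refine sub_eq_zero.1 (eq_zero_on_of_demand_eq_zero hLD W V (X - X') T hT.le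
        (fun j _ hj => sub_eq_zero.2 (hX j hj)) ?_ i (hTW hi))
      rw [demand_sub, hA, sub_self]
    · exact hX i hi

end Capacity

/-! ### Averaging over coordinates -/

section Averaging

variable {ι Ω : Type*} [Fintype ι] [DecidableEq ι] [Fintype Ω]

/-- The average of a function over the coordinates outside `A`. -/
noncomputable def avg (A : Finset ι) : ((ι → Ω) → ℝ) →ₗ[ℝ] ((ι → Ω) → ℝ) where
  toFun f x := (Fintype.card (ι → Ω) : ℝ)⁻¹ * ∑ z, f (A.piecewise x z)
  map_add' f g := by funext x; simp [Finset.sum_add_distrib, mul_add]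
  map_smul' c f := by funext x; simp [← Finset.mul_sum, mul_left_comm]

theorem avg_apply (A : Finset ι) (f : (ι → Ω) → ℝ) (x : ι → Ω) :
    avg A f x = (Fintype.card (ι → Ω) : ℝ)⁻¹ * ∑ z, f (A.piecewise x z) := rfl

theorem avg_of_const_on {A : Finset ι} {f : (ι → Ω) → ℝ} {x : ι → Ω} {c : ℝ}
    (h : ∀ z, f (A.piecewise x z) = c) : avg A f x = c := by
  have : Nonempty (ι → Ω) := ⟨x⟩
  rw [avg_apply, Finset.sum_congr rfl fun z _ => h z, Finset.sum_const, Finset.card_univ,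
    nsmul_eq_mul, inv_mul_cancel_left₀]
  exact_mod_cast Fintype.card_ne_zero

theorem avg_mono {A : Finset ι} {f g : (ι → Ω) → ℝ} {x : ι → Ω}
    (h : ∀ z, f (A.piecewise x z) ≤ g (A.piecewise x z)) : avg A f x ≤ avg A g x := by
  rw [avg_apply, avg_apply]
  exact mul_le_mul_of_nonneg_left (Finset.sum_le_sum fun z _ => h z) (by positivity)

theorem abs_avg_le {A : Finset ι} {f : (ι → Ω) → ℝ} {c : ℝ} (h : ∀ x, |f x| ≤ c) (x : ι → Ω) :
    |avg A f x| ≤ c := by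
  rw [abs_le]
  constructor
  · rw [← avg_of_const_on (A := A) (f := fun _ => -c) (x := x) fun _ => rfl]
    exact avg_mono fun z => (abs_le.1 (h _)).1
  · rw [← avg_of_const_on (A := A) (f := fun _ => c) (x := x) fun _ => rfl]
    exact avg_mono fun z => (abs_le.1 (h _)).2

/-- `avg A` is the conditional expectation given the coordinates in `A`; for independent coordinates
such expectations compose by intersection. -/
theorem avg_avg (A B : Finset ι) (f : (ι → Ω) → ℝ) : avg A (avg B f) = avg (A ∩ B) f := by
  funext x
  have : Nonempty (ι → Ω) := ⟨x⟩
  have hN : (Fintype.card (ι → Ω) : ℝ) ≠ 0 := by exact_mod_cast Fintype.card_ne_zero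
  have h1 : ∀ z w : ι → Ω, B.piecewise (A.piecewise x z) w =
      (A ∩ B).piecewise x (B.piecewise z w) := by
    intro z w
    funext i
    by_cases hA : i ∈ A <;> by_cases hB : i ∈ B <;> simp [hA, hB]
  -- Swapping the coordinates outside `B` between two samples turns the mixed sample into a single
  -- uniform one.
  have hinv : Function.Involutive fun p : (ι → Ω) × (ι → Ω) =>
      (B.piecewise p.1 p.2, B.piecewise p.2 p.1) := by
    rintro ⟨z, w⟩
    ext i <;> by_cases hB : i ∈ B <;> simp [hB]
  have h2 : ∑ z, ∑ w, f ((A ∩ B).piecewise x (B.piecewise z w)) =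
      Fintype.card (ι → Ω) * ∑ u, f ((A ∩ B).piecewise x u) := by
    rw [← Fintype.sum_prod_type' fun z w => f ((A ∩ B).piecewise x (B.piecewise z w))]
    rw [Fintype.sum_equiv (hinv.toPerm _)
      (fun p : (ι → Ω) × (ι → Ω) => f ((A ∩ B).piecewise x (B.piecewise p.1 p.2)))
      (fun p => f ((A ∩ B).piecewise x p.1)) fun p => rfl]
    rw [Fintype.sum_prod_type]
    simp [Finset.mul_sum]
  rw [avg_apply, avg_apply]
  simp only [avg_apply, h1]
  rw [← Finset.mul_sum, h2]
  field_simp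

theorem avg_comp_perm (A : Finset ι) (f : (ι → Ω) → ℝ) (ρ : Equiv.Perm ι) (hρ : ∀ i ∈ A, ρ i = i) :
    avg A (fun x => f (x ∘ ρ)) = avg A f := by
  funext x
  rw [avg_apply, avg_apply]
  congr 1
  refine Fintype.sum_equiv (ρ.symm.arrowCongr (Equiv.refl Ω)) _ _ fun z => ?_
  congr 1
  funext i
  by_cases hi : i ∈ A
  · simp [hi, hρ i hi]
  · have : ρ i ∉ A := by
      intro h
      have := ρ.injective (hρ _ h)
      rw [this] at h
      exact hi h
    simp [hi, this, Equiv.arrowCongr]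

/-- A function with the prescribed averages `φ A`, for `A` in the list, if they are consistent. -/
noncomputable def glue : List (Finset ι) → (Finset ι → (ι → Ω) → ℝ) →ₗ[ℝ] ((ι → Ω) → ℝ)
  | [] => 0
  | A :: l => glue l + LinearMap.proj A - avg A ∘ₗ glue l

theorem glue_cons (A : Finset ι) (l : List (Finset ι)) (φ : Finset ι → (ι → Ω) → ℝ) :
    glue (A :: l) φ = glue l φ + φ A - avg A (glue l φ) := rfl

theorem avg_glue (l : List (Finset ι)) (φ : Finset ι → (ι → Ω) → ℝ)
    (h1 : ∀ A ∈ l, avg A (φ A) = φ A) (h2 : ∀ A ∈ l, ∀ B ∈ l, avg A (φ B) = avg B (φ A)) :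
    ∀ A ∈ l, avg A (glue l φ) = φ A := by
  induction l with
  | nil => simp
  | cons B l ih =>
    have ih' := ih (fun A hA => h1 A (List.mem_cons_of_mem _ hA))
      fun A hA C hC => h2 A (List.mem_cons_of_mem _ hA) C (List.mem_cons_of_mem _ hC)
    intro A hA
    rw [glue_cons, map_sub, map_add]
    rcases List.mem_cons.1 hA with rfl | hA'
    · rw [avg_avg, Finset.inter_self, h1 A hA]; abel
    -- The correction `φ B - avg B (glue l φ)` has zero `A`-average, by consistency and since the
    -- averages commute.
    · rw [avg_avg, Finset.inter_comm, ← avg_avg, ih' A hA', h2 A hA B (by simp)]; abel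

/-- Each step of `glue` at most doubles the bound and adds `c`. -/
theorem abs_glue_le (l : List (Finset ι)) (φ : Finset ι → (ι → Ω) → ℝ) (c : ℝ)
    (h : ∀ A x, |φ A x| ≤ c) (x : ι → Ω) : |glue l φ x| ≤ (2 ^ l.length - 1) * c := by
  induction l generalizing x with
  | nil => simp [glue]
  | cons A l ih =>
    rw [glue_cons, List.length_cons, pow_succ]
    have h1 := ih x
    have h2 := h A x
    have h3 := abs_avg_le (A := A) ih x
    rw [Pi.sub_apply, Pi.add_apply]
    have h4 := abs_sub (glue l φ x + φ A x) (avg A (glue l φ) x)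
    have h5 := abs_add_le (glue l φ x) (φ A x)
    nlinarith

open Classical in
/-- The indicator function of a predicate. -/
noncomputable def ind (p : (ι → Ω) → Prop) (x : ι → Ω) : ℝ := if p x then 1 else 0

/-- If the condition `X` is likely given any point which is good on a set `A` in the family, then
some weight function on `X` has all averages equal to one at good points. -/
theorem exists_weight (𝒜 : Finset (Finset ι)) (good : Finset ι → (ι → Ω) → Prop)
    (X : (ι → Ω) → Prop) (ε : ℝ) (hε0 : 0 ≤ ε)
    (h1 : ∀ A ∈ 𝒜, ∀ x, X x → good A x)
    (h2 : ∀ A ∈ 𝒜, ∀ x y, (∀ i ∈ A, x i = y i) → good A x → good A y)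
    (h3 : ∀ A ∈ 𝒜, ∀ B ∈ 𝒜, avg A (ind (good B)) = avg B (ind (good A)))
    (h4 : ∀ A ∈ 𝒜, ∀ x, good A x → avg A (ind fun y => ¬ X y) x ≤ ε)
    (hε : 2 ^ (𝒜.card + 1) * ε ≤ 1) :
    ∃ μ : (ι → Ω) → ℝ, (∀ x, 0 ≤ μ x) ∧ (∀ x, ¬ X x → μ x = 0) ∧
      ∀ A ∈ 𝒜, ∀ x, good A x → avg A μ x = 1 := by
  classical
  set m := 𝒜.card with hm
  set l := 𝒜.toList with hl
  have hlen : l.length = m := 𝒜.length_toList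
  have hmem : ∀ {A}, A ∈ l ↔ A ∈ 𝒜 := fun {A} => Finset.mem_toList
  have hpw : ∀ A ∈ 𝒜, ∀ x z, X (A.piecewise x z) → good A x := by
    intro A hA x z hX
    refine h2 A hA _ _ (fun i hi => ?_) (h1 A hA _ hX)
    simp [hi]
  -- Consistent systems of marginals indexed by `𝒜` and supported at good points.
  let 𝒞 : Submodule ℝ (Finset ι → (ι → Ω) → ℝ) :=
    { carrier := {φ | (∀ A ∈ 𝒜, avg A (φ A) = φ A) ∧
        (∀ A ∈ 𝒜, ∀ B ∈ 𝒜, avg A (φ B) = avg B (φ A)) ∧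
        (∀ A ∈ 𝒜, ∀ x, ¬ good A x → φ A x = 0) ∧ ∀ A ∉ 𝒜, φ A = 0}
      add_mem' := by
        rintro φ χ ⟨a1, a2, a3, a4⟩ ⟨b1, b2, b3, b4⟩
        refine ⟨fun A hA => ?_, fun A hA B hB => ?_, fun A hA x hx => ?_, fun A hA => ?_⟩
        · rw [Pi.add_apply, map_add, a1 A hA, b1 A hA]
        · rw [Pi.add_apply, Pi.add_apply, map_add, map_add, a2 A hA B hB, b2 A hA B hB]
        · rw [Pi.add_apply, Pi.add_apply, a3 A hA x hx, b3 A hA x hx, add_zero]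
        · rw [Pi.add_apply, a4 A hA, b4 A hA, add_zero]
      zero_mem' := by
        refine ⟨fun A hA => ?_, fun A hA B hB => ?_, fun A hA x hx => rfl, fun A hA => rfl⟩
        · rw [Pi.zero_apply, map_zero]
        · rw [Pi.zero_apply, Pi.zero_apply, map_zero, map_zero]
      smul_mem' := by
        rintro c φ ⟨a1, a2, a3, a4⟩
        refine ⟨fun A hA => ?_, fun A hA B hB => ?_, fun A hA x hx => ?_, fun A hA => ?_⟩
        · rw [Pi.smul_apply, map_smul, a1 A hA]
        · rw [Pi.smul_apply, Pi.smul_apply, map_smul, map_smul, a2 A hA B hB]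
        · rw [Pi.smul_apply, Pi.smul_apply, a3 A hA x hx, smul_zero]
        · rw [Pi.smul_apply, a4 A hA, smul_zero] }
  -- Glue a system to one function, cut it down to `X`, and take its marginals. Without the cut this
  -- would be the identity on `𝒞`.
  let T : (Finset ι → (ι → Ω) → ℝ) →ₗ[ℝ] (Finset ι → (ι → Ω) → ℝ) :=
    LinearMap.pi fun A => if A ∈ 𝒜 then avg A ∘ₗ LinearMap.mulLeft ℝ (ind X) ∘ₗ glue l else 0
  have hT : ∀ φ, ∀ A ∈ 𝒜, T φ A = avg A (ind X * glue l φ) := by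
    intro φ A hA
    simp [T, hA]
  have hT' : ∀ φ, ∀ A ∉ 𝒜, T φ A = 0 := by
    intro φ A hA
    simp [T, hA]
  have hTC : ∀ φ, T φ ∈ 𝒞 := by
    intro φ
    refine ⟨fun A hA => ?_, fun A hA B hB => ?_, fun A hA x hx => ?_, hT' φ⟩
    · rw [hT φ A hA, avg_avg, Finset.inter_self]
    · rw [hT φ A hA, hT φ B hB, avg_avg, avg_avg, Finset.inter_comm]
    · rw [hT φ A hA]
      refine avg_of_const_on fun z => ?_
      have : ¬ X (A.piecewise x z) := fun h => hx (hpw A hA x z h)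
      simp [ind, this]
  have hle : ∀ φ : Finset ι → (ι → Ω) → ℝ, ∀ A x, |φ A x| ≤ ‖φ‖ := fun φ A x =>
    (norm_le_pi_norm (φ A) x).trans (norm_le_pi_norm φ A)
  have hglue : ∀ (φ : Finset ι → (ι → Ω) → ℝ) (x : ι → Ω), |glue l φ x| ≤ 2 ^ m * ‖φ‖ := by
    intro φ x
    have := abs_glue_le l φ ‖φ‖ (hle φ) x
    rw [hlen] at this
    nlinarith [norm_nonneg φ]
  -- The cut loses at most `ε` times the supremum of the glued function, hence at most `2 ^ m * ε ≤
  -- 1 / 2` relative to `‖φ‖`. So `T` is injective on the finite-dimensional space `𝒞`, hence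
  -- surjective.
  have hclose : ∀ φ ∈ 𝒞, ‖φ - T φ‖ ≤ 2⁻¹ * ‖φ‖ := by
    intro φ hφ
    have hnn : 0 ≤ 2⁻¹ * ‖φ‖ := by positivity
    rw [pi_norm_le_iff_of_nonneg hnn]
    intro A
    rw [pi_norm_le_iff_of_nonneg hnn]
    intro x
    rw [Pi.sub_apply, Pi.sub_apply]
    by_cases hA : A ∈ 𝒜
    · by_cases hx : good A x
      · have hφA : φ A = avg A (glue l φ) := (avg_glue l φ (fun A hA => hφ.1 A (hmem.1 hA))
          (fun A hA B hB => hφ.2.1 A (hmem.1 hA) B (hmem.1 hB)) A (hmem.2 hA)).symm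
        have hdiff : φ A x - T φ A x = avg A (ind (fun y => ¬ X y) * glue l φ) x := by
          rw [hφA, hT φ A hA, ← Pi.sub_apply, ← map_sub]
          refine congrFun (congrArg (avg A) (funext fun y => ?_)) x
          by_cases hy : X y <;> simp [ind, hy]
        rw [hdiff, Real.norm_eq_abs]
        have hb : |avg A (ind (fun y => ¬ X y) * glue l φ) x| ≤
            avg A ((2 ^ m * ‖φ‖) • ind fun y => ¬ X y) x := by
          have hpt : ∀ y : ι → Ω, |(ind (fun y => ¬ X y) * glue l φ) y| ≤
              ((2 ^ m * ‖φ‖) • ind fun y => ¬ X y) y := by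
            intro y
            by_cases hy : X y
            · simp [ind, hy]
            · simpa [ind, hy] using hglue φ y
          rw [abs_le]
          refine ⟨?_, avg_mono fun z => (abs_le.1 (hpt _)).2⟩
          rw [← Pi.neg_apply, ← map_neg]
          exact avg_mono fun z => (abs_le.1 (hpt _)).1
        refine hb.trans ?_
        rw [map_smul, Pi.smul_apply, smul_eq_mul]
        have h5 := h4 A hA x hx
        have h6 : 2 ^ m * ‖φ‖ * avg A (ind fun y => ¬ X y) x ≤ 2 ^ m * ‖φ‖ * ε :=
          mul_le_mul_of_nonneg_left h5 (by positivity)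
        rw [pow_succ] at hε
        nlinarith [norm_nonneg φ]
      · rw [hφ.2.2.1 A hA x hx, (hTC φ).2.2.1 A hA x hx]
        simp
    · rw [hφ.2.2.2 A hA, hT' φ A hA]
      simp
  let Tc : 𝒞 →ₗ[ℝ] 𝒞 := T.restrict fun φ _ => hTC φ
  have hinj : Function.Injective Tc := by
    rw [← LinearMap.ker_eq_bot, LinearMap.ker_eq_bot']
    rintro ⟨φ, hφ⟩ h0
    have h0' : T φ = 0 := congrArg Subtype.val h0
    have := hclose φ hφ
    rw [h0', sub_zero] at this
    have h7 : ‖φ‖ = 0 := by nlinarith [norm_nonneg φ]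
    exact Subtype.ext (norm_eq_zero.1 h7)
  have hsurj : Function.Surjective Tc := LinearMap.injective_iff_surjective.1 hinj
  -- The defect of the marginals of the constant weight on `X`; solving `T ψ = δ` repairs it.
  let δ : Finset ι → (ι → Ω) → ℝ := fun A => if A ∈ 𝒜 then ind (good A) - avg A (ind X) else 0
  have hδ : ∀ A ∈ 𝒜, δ A = ind (good A) - avg A (ind X) := fun A hA => by simp [δ, hA]
  have hδ0 : ∀ A ∈ 𝒜, ∀ x, ¬ good A x → δ A x = 0 := by
    intro A hA x hx
    rw [hδ A hA, Pi.sub_apply, avg_of_const_on (c := 0) fun z => ?_]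
    · simp [ind, hx]
    · have : ¬ X (A.piecewise x z) := fun h => hx (hpw A hA x z h)
      simp [ind, this]
  have hgoodavg : ∀ A ∈ 𝒜, avg A (ind (good A)) = ind (good A) := by
    intro A hA
    funext x
    refine avg_of_const_on fun z => ?_
    have : good A (A.piecewise x z) ↔ good A x :=
      ⟨h2 A hA _ _ fun i hi => by simp [hi], h2 A hA _ _ fun i hi => by simp [hi]⟩
    simp [ind, this]
  have hδC : δ ∈ 𝒞 := by
    refine ⟨fun A hA => ?_, fun A hA B hB => ?_, hδ0, fun A hA => by simp [δ, hA]⟩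
    · rw [hδ A hA, map_sub, avg_avg, Finset.inter_self, hgoodavg A hA]
    · rw [hδ A hA, hδ B hB, map_sub, map_sub, avg_avg, avg_avg, Finset.inter_comm, h3 A hA B hB]
  have hδn : ‖δ‖ ≤ ε := by
    rw [pi_norm_le_iff_of_nonneg hε0]
    intro A
    rw [pi_norm_le_iff_of_nonneg hε0]
    intro x
    by_cases hA : A ∈ 𝒜
    · by_cases hx : good A x
      · have h8 : δ A x = avg A (ind fun y => ¬ X y) x := by
          have h9 : (ind fun y => ¬ X y) = (fun _ => (1 : ℝ)) - ind X := by
            funext y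
            by_cases hy : X y <;> simp [ind, hy]
          rw [hδ A hA, h9, map_sub, Pi.sub_apply, Pi.sub_apply,
            avg_of_const_on (A := A) (f := fun _ => (1 : ℝ)) fun _ => rfl]
          simp [ind, hx]
        have h10 : 0 ≤ avg A (ind fun y => ¬ X y) x := by
          rw [← avg_of_const_on (A := A) (f := fun _ => (0 : ℝ)) (x := x) fun _ => rfl]
          refine avg_mono fun z => ?_
          unfold ind; split_ifs <;> norm_num
        rw [h8, Real.norm_eq_abs, abs_of_nonneg h10]
        exact h4 A hA x hx
      · rw [hδ0 A hA x hx]; simpa using hε0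
    · have : δ A = 0 := by simp [δ, hA]
      rw [this]; simpa using hε0
  obtain ⟨⟨ψ, hψ⟩, hψδ⟩ := hsurj ⟨δ, hδC⟩
  have hψδ' : T ψ = δ := congrArg Subtype.val hψδ
  have hψn : ‖ψ‖ ≤ 2 * ε := by
    have h11 := hclose ψ hψ
    rw [hψδ'] at h11
    have h12 := norm_sub_norm_le ψ δ
    linarith
  have hsmall : ∀ x, |glue l ψ x| ≤ 1 := by
    intro x
    refine (hglue ψ x).trans (le_trans ?_ hε)
    rw [pow_succ]
    have : (0 : ℝ) ≤ 2 ^ m := by positivity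
    nlinarith
  -- Nonnegativity holds because `‖ψ‖ ≤ 2 * ε` keeps the glued correction within `[-1, 1]`.
  refine ⟨ind X * (1 + glue l ψ), fun x => ?_, fun x hx => ?_, fun A hA x hx => ?_⟩
  · have := (abs_le.1 (hsmall x)).1
    by_cases hX : X x <;> simp [ind, hX]
    linarith
  · simp [ind, hx]
  · rw [mul_add, mul_one, map_add, ← hT ψ A hA, hψδ', hδ A hA]
    simp [ind, hx]

end Averaging

/-! ### Random arcs with uniform restrictions -/

section RandomArc

variable {F : Type*} [Field F] {ι : Type*} [Fintype ι] [DecidableEq ι] {k : ℕ}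

theorem arcOn_perm_iff (ρ : Equiv.Perm ι) (A : Finset ι) (x : ι → Fin k → F) :
    ArcOn A (x ∘ ρ) ↔ ArcOn (A.map ρ.toEmbedding) x := by
  have aux : ∀ (ρ : Equiv.Perm ι) (A : Finset ι) (x : ι → Fin k → F), ArcOn A x →
      ArcOn (A.map ρ.toEmbedding) (x ∘ ρ.symm) := by
    intro ρ A x h c hc hk hs
    have h1 : c ∘ ρ = 0 := by
      refine h _ (fun i hi => hc _ (by simpa using hi)) ?_ ?_
      · rw [Function.support_comp_eq_preimage, Set.ncard_preimage_of_injective_subset_range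
          ρ.injective (by simp)]
        exact hk
      · rw [← hs]
        exact Fintype.sum_equiv ρ _ _ fun i => by simp
    funext i
    have := congrFun h1 (ρ.symm i)
    simpa using this
  constructor
  · intro h
    have := aux ρ A _ h
    simpa [Function.comp_assoc] using this
  · intro h
    have := aux ρ.symm _ x h
    have h2 : (A.map ρ.toEmbedding).map ρ.symm.toEmbedding = A := by
      ext i; simp
    rw [h2] at this
    simpa using this

theorem exists_perm_map_eq (A B : Finset ι) (h : A.card = B.card) :
    ∃ ρ : Equiv.Perm ι, (∀ i ∈ A ∩ B, ρ i = i) ∧ A.map ρ.toEmbedding = B := by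
  obtain ⟨g, hg⟩ := Finset.exists_equiv_extend_of_card_eq (α := A) (t := B) (by simpa using h)
    (s := Finset.univ.filter fun i : A => (i : ι) ∈ B) (f := fun i => (i : ι))
    (by intro i hi; obtain ⟨j, hj, rfl⟩ := Finset.mem_image.1 hi; exact (Finset.mem_filter.1 hj).2)
    (Subtype.val_injective.injOn)
  have hρ : ∀ i (hi : i ∈ A), (g : A ≃ B).extendSubtype i = g ⟨i, hi⟩ := fun i hi =>
    Equiv.extendSubtype_apply_of_mem _ i hi
  refine ⟨(g : A ≃ B).extendSubtype, ?_, ?_⟩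
  · intro i hi
    rw [Finset.mem_inter] at hi
    rw [hρ i hi.1]
    exact hg ⟨i, hi.1⟩ (by simpa using hi.2)
  · apply Finset.eq_of_subset_of_card_le
    · intro i hi
      obtain ⟨j, hj, rfl⟩ := Finset.mem_map.1 hi
      rw [Equiv.coe_toEmbedding, hρ j hj]
      exact (g ⟨j, hj⟩).2
    · rw [Finset.card_map, h]

variable [Fintype F]

theorem avg_ind_arcOn (A : Finset ι) :
    avg A (ind (ArcOn A : (ι → Fin k → F) → Prop)) = ind (ArcOn A) := by
  classical
  funext x
  refine avg_of_const_on fun z => ?_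
  have : ArcOn A (A.piecewise x z) ↔ ArcOn A x :=
    ⟨ArcOn.congr fun i hi => by simp [hi], ArcOn.congr fun i hi => by simp [hi]⟩
  simp [ind, this]

/-- Both sides are averages given the coordinates in `A ∩ B`. A permutation fixing `A ∩ B` and
carrying `A` to `B` identifies them. -/
theorem avg_ind_arcOn_comm (A B : Finset ι) (h : A.card = B.card) :
    avg A (ind (ArcOn B : (ι → Fin k → F) → Prop)) = avg B (ind (ArcOn A)) := by
  rw [← avg_ind_arcOn B, avg_avg, ← avg_ind_arcOn A, avg_avg, Finset.inter_comm B A]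
  obtain ⟨ρ, hfix, hmap⟩ := exists_perm_map_eq A B h
  rw [← avg_comp_perm (A ∩ B) (ind (ArcOn A)) ρ hfix]
  congr 1
  funext x
  unfold ind
  rw [arcOn_perm_iff, hmap]

/-- Fewer than `k` vectors span a proper subspace. Translating `x j` along a vector outside it gives
`|F|` disjoint copies of the event. -/
theorem avg_mem_span_le (j : ι) (I : Finset ι) (hj : j ∉ I) (hI : I.card < k)
    (y : ι → Fin k → F) :
    avg (Finset.univ.erase j) (ind fun x : ι → Fin k → F =>
      x j ∈ Submodule.span F (x '' (I : Set ι))) y ≤ (Fintype.card F : ℝ)⁻¹ := by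
  classical
  set S := Submodule.span F (y '' (I : Set ι)) with hS
  have hpw : ∀ z : ι → Fin k → F, ind (fun x : ι → Fin k → F =>
      x j ∈ Submodule.span F (x '' (I : Set ι))) ((Finset.univ.erase j).piecewise y z) =
      if z j ∈ S then 1 else 0 := by
    intro z
    have h1 : (Finset.univ.erase j).piecewise y z j = z j := by simp
    have h2 : (Finset.univ.erase j).piecewise y z '' (I : Set ι) = y '' (I : Set ι) := by
      refine Set.image_congr fun i hi => ?_
      have : i ≠ j := by rintro rfl; exact hj hi
      simp [this]
    unfold ind
    beta_reduce
    rw [h1, h2]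
  obtain ⟨v, hv⟩ : ∃ v, v ∉ S := by
    by_contra hall
    push Not at hall
    have htop : S = ⊤ := Submodule.eq_top_iff'.2 hall
    have h1 : Module.finrank F S ≤ I.card := by
      have h2 : y '' (I : Set ι) = ((I.image y : Finset _) : Set (Fin k → F)) := by simp
      rw [hS, h2]
      exact (finrank_span_finset_le_card _).trans Finset.card_image_le
    rw [htop, finrank_top, Module.finrank_fintype_fun_eq_card, Fintype.card_fin] at h1
    omega
  have hcount : Fintype.card F * Fintype.card {z : ι → Fin k → F // z j ∈ S} ≤
      Fintype.card (ι → Fin k → F) := by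
    rw [← Fintype.card_prod]
    refine Fintype.card_le_of_injective
      (fun p => Function.update p.2.1 j (p.2.1 j + p.1 • v)) ?_
    rintro ⟨c, z, hz⟩ ⟨c', z', hz'⟩ he
    have hne : ∀ i, i ≠ j → z i = z' i := by
      intro i hi
      have := congrFun he i
      simpa [hi] using this
    have hjj : z j + c • v = z' j + c' • v := by
      have := congrFun he j
      simpa using this
    have hmem : (c - c') • v ∈ S := by
      have : (c - c') • v = z' j - z j := by
        rw [sub_smul, sub_eq_sub_iff_add_eq_add, add_comm, hjj]
      rw [this]; exact S.sub_mem hz' hz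
    have hcc : c = c' := by
      by_contra hc
      exact hv ((S.smul_mem_iff (sub_ne_zero.2 hc)).1 hmem)
    subst hcc
    have hzz : z = z' := by
      funext i
      by_cases hi : i = j
      · subst hi; exact add_right_cancel hjj
      · exact hne i hi
    subst hzz; rfl
  rw [avg_apply, Finset.sum_congr rfl fun z _ => hpw z, Finset.sum_boole,
    ← Fintype.card_subtype]
  have hN : (0 : ℝ) < Fintype.card (ι → Fin k → F) := by exact_mod_cast Fintype.card_pos
  have hp : (0 : ℝ) < Fintype.card F := by exact_mod_cast Fintype.card_pos
  rw [← div_eq_inv_mul, div_le_iff₀ hN, ← div_eq_inv_mul, le_div_iff₀ hp, mul_comm]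
  exact_mod_cast hcount

/-- A union bound: a forbidden relation must involve some `j ∉ A`, so `y j` lies in the span of
fewer than `k` other vectors. There are at most `|ι| * 2 ^ |ι|` choices of `j` and of these vectors.
-/
theorem avg_not_arcOn_le (A : Finset ι) (x : ι → Fin k → F) (hx : ArcOn A x) :
    avg A (ind fun y => ¬ ArcOn Finset.univ y) x ≤
      (Fintype.card ι * 2 ^ Fintype.card ι : ℕ) * (Fintype.card F : ℝ)⁻¹ := by
  classical
  let P : Finset (ι × Finset ι) := (Finset.univ : Finset (ι × Finset ι)).filter
    fun p => p.1 ∉ A ∧ p.1 ∉ p.2 ∧ p.2.card < k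
  let g : ι × Finset ι → (ι → Fin k → F) → ℝ := fun p =>
    ind fun y => y p.1 ∈ Submodule.span F (y '' (p.2 : Set ι))
  have hg0 : ∀ p y, 0 ≤ g p y := by
    intro p y; simp only [g, ind]; split_ifs <;> norm_num
  have h1 : avg A (ind fun y => ¬ ArcOn Finset.univ y) x ≤ avg A (∑ p ∈ P, g p) x := by
    refine avg_mono fun z => ?_
    set y := A.piecewise x z with hy
    rw [Finset.sum_apply]
    by_cases hX : ArcOn Finset.univ y
    · simp only [ind, hX, not_true_eq_false, if_false]
      exact Finset.sum_nonneg fun p _ => hg0 p y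
    · have hyA : ArcOn A y := hx.congr fun i hi => by simp [hy, hi]
      have : ∃ p ∈ P, y p.1 ∈ Submodule.span F (y '' (p.2 : Set ι)) := by
        unfold ArcOn at hX
        push Not at hX
        obtain ⟨c, -, hk, hs, hc⟩ := hX
        obtain ⟨j, hjA, hj⟩ : ∃ j, j ∉ A ∧ c j ≠ 0 := by
          by_contra hall
          push Not at hall
          exact hc (hyA c hall hk hs)
        have hcard : (Function.support c).toFinset.card ≤ k := by
          rwa [← Set.ncard_eq_toFinset_card']
        have hjmem : j ∈ (Function.support c).toFinset := by simpa using hj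
        refine ⟨(j, (Function.support c).toFinset.erase j), ?_, ?_⟩
        · simp only [P, Finset.mem_filter, Finset.mem_univ, true_and]
          refine ⟨hjA, Finset.notMem_erase _ _, ?_⟩
          exact lt_of_lt_of_le (Finset.card_erase_lt_of_mem hjmem) hcard
        · have hsum : c j • y j = -∑ i ∈ (Function.support c).toFinset.erase j, c i • y i := by
            rw [eq_neg_iff_add_eq_zero, Finset.add_sum_erase _ (fun i => c i • y i) hjmem, ← hs]
            exact Finset.sum_subset (Finset.subset_univ _) fun i _ hi => by
              have : c i = 0 := by simpa using hi
              rw [this, zero_smul]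
          rw [← Submodule.smul_mem_iff _ hj]
          change c j • y j ∈ _
          rw [hsum]
          refine Submodule.neg_mem _ (Submodule.sum_mem _ fun i hi => ?_)
          exact Submodule.smul_mem _ _ (Submodule.subset_span ⟨i, hi, rfl⟩)
      obtain ⟨p, hp, hpy⟩ := this
      have h2 : g p y = 1 := by simp only [g, ind, hpy, if_true]
      have h3 := Finset.single_le_sum (f := fun p => g p y) (fun p _ => hg0 p y) hp
      simp only [ind, hX, not_false_eq_true, if_true]
      rw [← h2]; exact h3
  refine h1.trans ?_
  rw [map_sum, Finset.sum_apply]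
  have h4 : ∀ p ∈ P, avg A (g p) x ≤ (Fintype.card F : ℝ)⁻¹ := by
    intro p hp
    simp only [P, Finset.mem_filter, Finset.mem_univ, true_and] at hp
    have hA : A ∩ Finset.univ.erase p.1 = A := by
      rw [Finset.inter_eq_left]
      intro i hi
      simp only [Finset.mem_erase, Finset.mem_univ, and_true]
      rintro rfl; exact hp.1 hi
    rw [show avg A (g p) = avg A (avg (Finset.univ.erase p.1) (g p)) by rw [avg_avg, hA],
      ← avg_of_const_on (A := A) (f := fun _ => (Fintype.card F : ℝ)⁻¹) (x := x) fun _ => rfl]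
    exact avg_mono fun z => avg_mem_span_le p.1 p.2 hp.2.1 hp.2.2 _
  refine (Finset.sum_le_card_nsmul P _ _ h4).trans ?_
  rw [nsmul_eq_mul]
  refine mul_le_mul_of_nonneg_right ?_ (by positivity)
  have : P.card ≤ Fintype.card ι * 2 ^ Fintype.card ι := by
    refine (Finset.card_le_univ P).trans ?_
    rw [Fintype.card_prod, Fintype.card_finset]
  exact_mod_cast this

/-- The union bound with `A = ∅`: the failure probability is below one. -/
theorem exists_arc (hF : Fintype.card ι * 2 ^ Fintype.card ι < Fintype.card F) :
    ∃ x : ι → Fin k → F, ArcOn Finset.univ x := by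
  classical
  by_contra hall
  push Not at hall
  have h0 : ArcOn (∅ : Finset ι) (0 : ι → Fin k → F) := fun c hc _ _ =>
    funext fun i => hc i (Finset.notMem_empty i)
  have h1 := avg_not_arcOn_le ∅ (0 : ι → Fin k → F) h0
  rw [avg_of_const_on (c := 1) fun z => by simp [ind, hall]] at h1
  have hp : (0 : ℝ) < Fintype.card F := by exact_mod_cast Fintype.card_pos
  rw [← div_eq_mul_inv, le_div_iff₀ hp, one_mul] at h1
  have : Fintype.card F ≤ Fintype.card ι * 2 ^ Fintype.card ι := by exact_mod_cast h1
  omega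

/-- Translates averages given the coordinates in the range of `e` into sums over fibres of
restriction. The factor counts the values of `z` on that range, which are overwritten by `x`. -/
theorem sum_comp_piecewise {Ω κ : Type*} [Fintype Ω] [Nonempty Ω] [Fintype κ] (e : κ ↪ ι)
    (μ : (ι → Ω) → ℝ) (x : ι → Ω) [DecidableEq Ω] :
    ∑ z, μ ((Finset.univ.map e).piecewise x z) =
      (Fintype.card Ω : ℝ) ^ Fintype.card κ * ∑ z, if z ∘ e = x ∘ e then μ z else 0 := by
  classical
  have hmem : ∀ i, i ∈ Finset.univ.map e ↔ ∃ a, e a = i := by simp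
  have hcard : ∀ y : ι → Ω, y ∘ e = x ∘ e →
      (Finset.univ.filter fun z : ι → Ω => (Finset.univ.map e).piecewise x z = y).card =
        Fintype.card Ω ^ Fintype.card κ := by
    intro y hy
    rw [← Fintype.card_subtype, ← Fintype.card_fun]
    refine Fintype.card_congr ⟨fun z => z.1 ∘ e, fun w =>
      ⟨fun i => if h : ∃ a, e a = i then w h.choose else y i, ?_⟩, ?_, ?_⟩
    · funext i
      by_cases hi : ∃ a, e a = i
      · obtain ⟨a, rfl⟩ := hi
        have := congrFun hy a
        simp only [Function.comp] at this
        simp [this]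
      · have hi' : i ∉ Finset.univ.map e := by rwa [hmem]
        rw [Finset.piecewise_eq_of_notMem _ _ _ hi', dif_neg hi]
    · rintro ⟨z, hz⟩
      apply Subtype.ext
      funext i
      by_cases hi : ∃ a, e a = i
      · simp only [dif_pos hi, Function.comp]
        rw [hi.choose_spec]
      · have hi' : i ∉ Finset.univ.map e := by rwa [hmem]
        simp only [dif_neg hi]
        rw [← hz, Finset.piecewise_eq_of_notMem _ _ _ hi']
    · intro w
      funext a
      have h : ∃ b, e b = e a := ⟨a, rfl⟩
      simp only [Function.comp, dif_pos h]
      rw [e.injective h.choose_spec]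
  calc ∑ z, μ ((Finset.univ.map e).piecewise x z)
      = ∑ y, ∑ z with (Finset.univ.map e).piecewise x z = y,
          μ ((Finset.univ.map e).piecewise x z) := (Finset.sum_fiberwise _ _ _).symm
    _ = ∑ y, (Fintype.card Ω : ℝ) ^ Fintype.card κ * if y ∘ e = x ∘ e then μ y else 0 := by
        refine Finset.sum_congr rfl fun y _ => ?_
        rw [Finset.sum_congr rfl fun z hz => by rw [(Finset.mem_filter.1 hz).2]]
        rw [Finset.sum_const, nsmul_eq_mul]
        by_cases hy : y ∘ e = x ∘ e
        · rw [hcard y hy, if_pos hy]; push_cast; rfl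
        · rw [if_neg hy, mul_zero]
          have : (Finset.univ.filter fun z : ι → Ω =>
              (Finset.univ.map e).piecewise x z = y) = ∅ := by
            rw [Finset.filter_eq_empty_iff]
            rintro z - rfl
            apply hy
            funext a
            simp
          rw [this]; simp
    _ = _ := by rw [Finset.mul_sum]

open Classical in
/-- Over a large field there is a random arc all of whose restrictions to `D` points are uniformly
distributed over the arcs with `D` points, up to normalization. -/
theorem exists_arc_weight (k D : ℕ)
    (hF : 2 ^ (2 ^ Fintype.card ι + 1) * (Fintype.card ι * 2 ^ Fintype.card ι) ≤ Fintype.card F) :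
    ∃ μ : (ι → Fin k → F) → ℝ≥0∞, (∀ x, μ x ≠ 0 → ArcOn Finset.univ x) ∧ (∀ x, μ x ≠ ∞) ∧
      ∀ (e : Fin D ↪ ι) (y : Fin D → Fin k → F), ArcOn Finset.univ y →
        ∑' x, (if x ∘ e = y then μ x else 0) = 1 := by
  classical
  have hp : (0 : ℝ) < Fintype.card F := by exact_mod_cast Fintype.card_pos
  obtain ⟨μ, hμ0, hμX, hμ⟩ := exists_weight (Finset.univ.powersetCard D)
    (ArcOn : Finset ι → (ι → Fin k → F) → Prop) (ArcOn Finset.univ)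
    ((Fintype.card ι * 2 ^ Fintype.card ι : ℕ) * (Fintype.card F : ℝ)⁻¹) (by positivity)
    (fun A _ x hx => hx.mono (Finset.subset_univ A)) (fun A _ x y hxy hx => hx.congr hxy)
    (fun A hA B hB => avg_ind_arcOn_comm A B
      ((Finset.mem_powersetCard.1 hA).2.trans (Finset.mem_powersetCard.1 hB).2.symm))
    (fun A _ x hx => avg_not_arcOn_le A x hx) (by
      rw [← mul_assoc, ← div_eq_mul_inv, div_le_one hp]
      have h1 : (Finset.powersetCard D (Finset.univ : Finset ι)).card ≤ 2 ^ Fintype.card ι := by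
        rw [← Fintype.card_finset]; exact Finset.card_le_univ _
      have h2 : 2 ^ ((Finset.powersetCard D (Finset.univ : Finset ι)).card + 1) *
          (Fintype.card ι * 2 ^ Fintype.card ι) ≤ Fintype.card F :=
        (Nat.mul_le_mul_right _ (Nat.pow_le_pow_right (by norm_num) (by omega))).trans hF
      exact_mod_cast h2)
  -- The sum of `μ` over a fibre of restriction to `D` points when the corresponding average is one;
  -- dividing by it normalizes all these sums.
  set c : ℝ := (Fintype.card (ι → Fin k → F) : ℝ) / (Fintype.card (Fin k → F) : ℝ) ^ D with hc
  have hc0 : 0 < c := by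
    have h1 : (0 : ℝ) < Fintype.card (ι → Fin k → F) := by exact_mod_cast Fintype.card_pos
    have h2 : (0 : ℝ) < Fintype.card (Fin k → F) := by exact_mod_cast Fintype.card_pos
    positivity
  refine ⟨fun x => ENNReal.ofReal (μ x / c), fun x hx => ?_, fun x => ENNReal.ofReal_ne_top,
    fun e y hy => ?_⟩
  · by_contra hX
    simp [hμX x hX] at hx
  · let x₀ : ι → Fin k → F := Function.extend e y 0
    have hx₀ : x₀ ∘ e = y := Function.extend_comp e.injective _ _
    have hgood : ArcOn (Finset.univ.map e) x₀ := by
      rw [← arcOn_comp_iff, hx₀]; exact hy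
    have h1 := hμ (Finset.univ.map e) (by simp [Finset.mem_powersetCard]) x₀ hgood
    rw [avg_apply, sum_comp_piecewise, hx₀, Fintype.card_fin] at h1
    rw [tsum_fintype]
    have h2 : ∀ x, (if x ∘ e = y then ENNReal.ofReal (μ x / c) else 0) =
        ENNReal.ofReal ((if x ∘ e = y then μ x else 0) / c) := by
      intro x; split_ifs <;> simp
    rw [Finset.sum_congr rfl fun x _ => h2 x, ← ENNReal.ofReal_sum_of_nonneg, ← Finset.sum_div]
    · rw [ENNReal.ofReal_eq_one, div_eq_one_iff_eq hc0.ne', hc, eq_div_iff, mul_comm]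
      · rwa [inv_mul_eq_one₀, eq_comm] at h1
        exact_mod_cast Fintype.card_ne_zero
      · exact_mod_cast (pow_pos Fintype.card_pos D).ne'
    · intro x _
      refine div_nonneg ?_ hc0.le
      split_ifs
      exacts [hμ0 x, le_rfl]

end RandomArc

/-! ### Protocols from combinatorial designs -/

theorem prob_eq_tsum_fiber {Ω α : Type*} (μ : PMF Ω) (Y : Ω → α) (s : Set Ω) :
    prob μ s = ∑' q, prob μ (s ∩ {ω | Y ω = q}) := by
  classical
  unfold prob
  simp only [PMF.toOuterMeasure_apply]
  rw [ENNReal.tsum_comm]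
  refine tsum_congr fun ω => ?_
  rw [tsum_eq_single (Y ω)]
  · by_cases h : ω ∈ s <;> simp [Set.indicator, h]
  · intro q hq
    simp [Set.indicator, hq.symm]

section Design

variable {F E : Type u} [Field F] [Fintype F] [Field E] [Fintype E] [Algebra F E] {K D L : ℕ}

/-- Privacy is required in unnormalized form, with an unspecified constant `c`; summing over all
queries identifies `c` with the prior probability. An answer of `r` symbols has entropy at most `r *
log₂ |E|`. -/
theorem le_capacity_of_query {𝒬 : Type u} (hLD : L ≤ D) (hDK : D ≤ K)
    (hV : Nonempty (MDSMatrix F L D)) {r : ℕ} (hr : 1 ≤ r)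
    (query : Support K D → MDSMatrix F L D → PMF 𝒬) (ans : 𝒬 → (Fin K → E) → (Fin r → E))
    (c : ℝ≥0∞)
    (hpriv : ∀ q (i : Fin K), (∑ W : Support K D, ∑ V, if i ∈ W.1 then query W V q else 0) =
      c * ∑ W, ∑ V, query W V q)
    (hrec : ∀ W V q, query W V q ≠ 0 → ∀ X X', ans q X = ans q X' →
      demand W V X = demand W V X') :
    ENNReal.ofReal ((L : ℝ) / r) ≤ capacity F E hDK hV := by
  have : Nonempty E := ⟨0⟩
  let P : Scheme F E K D L := ⟨𝒬, Fin r → E, query, ans⟩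
  have hjoint : ∀ (q : P.Query) (i : Fin K),
      prob (P.law hDK hV) ({ω | i ∈ ω.W.1} ∩ {ω | ω.Q = q}) =
        c * prob (P.law hDK hV) {ω | ω.Q = q} := by
    intro q i
    rw [P.prob_law hDK hV (fun W => i ∈ W.1) q]
    have h1 := P.prob_law hDK hV (fun _ => True) q
    simp only [Set.ofPred_true, Set.univ_inter, if_true] at h1
    rw [h1, mul_left_comm]
    congr 1
    exact hpriv q i
  have hone : ∑' q : P.Query, prob (P.law hDK hV) {ω | ω.Q = q} = 1 := by
    have h1 := prob_eq_tsum_fiber (P.law hDK hV) (fun ω => ω.Q) Set.univ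
    simp only [Set.univ_inter] at h1
    rw [← h1, prob, PMF.toOuterMeasure_apply, Set.indicator_univ, PMF.tsum_coe]
  have hP : P.IsProtocol hDK hV := by
    constructor
    · intro q hq i
      have h2 : prob (P.law hDK hV) {ω | ω.Q = q} ≠ ∞ := by
        refine ne_top_of_le_ne_top ENNReal.one_ne_top ?_
        rw [← hone]
        exact ENNReal.le_tsum q
      rw [condProb, hjoint, ENNReal.mul_div_cancel_right hq h2,
        prob_eq_tsum_fiber (P.law hDK hV) (fun ω => ω.Q) {ω | i ∈ ω.W.1}]
      rw [tsum_congr fun q => hjoint q i, ENNReal.tsum_mul_left, hone, mul_one]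
    · rw [P.recoverable_iff hDK hV]
      exact fun W V Q hQ => hrec W V Q ((PMF.mem_support_iff _ _).1 hQ)
  have hq : (1 : ℝ) < Fintype.card E := by exact_mod_cast Fintype.one_lt_card
  refine le_trans ?_ (le_iSup₂_of_le (f := fun (P : Scheme F E K D L)
    (_ : P.IsProtocol hDK hV) => P.rate hDK hV) P hP le_rfl)
  refine le_div_of_entropy hq hr (log_card_le_entropy_demand P hLD hDK hV) ?_
  have h3 : Fintype.card (Fin r → E) = Fintype.card E ^ r := by
    rw [Fintype.card_fun, Fintype.card_fin]
  have h4 : entropy (P.law hDK hV) P.A ≤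
      ENNReal.ofReal (Real.log (Fintype.card (Fin r → E)) / Real.log 2) :=
    entropy_le_log_card (α := Fin r → E) (P.law hDK hV) P.A
  rwa [h3, Nat.cast_pow] at h4

open Classical in
/-- A protocol from a weighted family of queries `q`, each of which is compatible with the demand
supports `supp q s`, and with the coefficient matrices in `rel q s`. -/
theorem le_capacity_of_design {𝒬 : Type u} {𝒮 : Type*} [Fintype 𝒬] [Fintype 𝒮]
    (hLD : L ≤ D) (hDK : D ≤ K)
    (hV : Nonempty (MDSMatrix F L D)) {r : ℕ} (hr : 1 ≤ r)
    (ans : 𝒬 → (Fin K → E) → (Fin r → E)) (μ : 𝒬 → ℝ≥0∞) (w : 𝒮 → ℝ≥0∞)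
    (supp : 𝒬 → 𝒮 → Support K D) (rel : 𝒬 → 𝒮 → MDSMatrix F L D → Prop)
    (c n a b : ℝ≥0∞) (hc0 : c ≠ 0) (hc : c ≠ ∞) (hb0 : b ≠ 0) (hb : b ≠ ∞)
    (htotal : ∀ W V, ∑ q, ∑ s, (if supp q s = W ∧ rel q s V then μ q * w s else 0) = c)
    (hrel : ∀ q, μ q ≠ 0 → ∀ s, ∑ V, (if rel q s V then (1 : ℝ≥0∞) else 0) = n)
    (hcover : ∀ q i, ∑ s, (if i ∈ (supp q s).1 then w s else 0) = a)
    (hw : ∑ s, w s = b)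
    (hrec : ∀ q s V, μ q ≠ 0 → rel q s V → ∀ X X', ans q X = ans q X' →
      demand (supp q s) V X = demand (supp q s) V X') :
    ENNReal.ofReal ((L : ℝ) / r) ≤ capacity F E hDK hV := by
  -- Given `(W, V)`, draw a compatible pair of query and slot with probability proportional to its
  -- weight `μ q * w s`.
  let f : Support K D → MDSMatrix F L D → 𝒬 → ℝ≥0∞ := fun W V q =>
    (∑ s, if supp q s = W ∧ rel q s V then μ q * w s else 0) * c⁻¹
  have hf : ∀ W V, ∑ q, f W V q = 1 := by
    intro W V
    rw [← Finset.sum_mul, htotal, ENNReal.mul_inv_cancel hc0 hc]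
  -- Each slot of a query admits the same number `n` of matrices, so given the query the true slot
  -- is distributed in proportion to `w`.
  have hsum : ∀ (q : 𝒬) (p : Support K D → Prop),
      ∑ W, ∑ V, (if p W then f W V q else 0) =
        μ q * n * c⁻¹ * ∑ s, if p (supp q s) then w s else 0 := by
    intro q p
    by_cases hq : μ q = 0
    · simp [f, hq]
    · calc ∑ W, ∑ V, (if p W then f W V q else 0)
          = ∑ W, ∑ V, ∑ s, (if supp q s = W then
              (if p W then (if rel q s V then 1 else 0) * (μ q * w s * c⁻¹) else 0) else 0) := by
            refine Finset.sum_congr rfl fun W _ => Finset.sum_congr rfl fun V _ => ?_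
            by_cases hp : p W
            · simp only [hp, if_true, f, Finset.sum_mul]
              refine Finset.sum_congr rfl fun s _ => ?_
              by_cases h1 : supp q s = W <;> by_cases h2 : rel q s V <;> simp [h1, h2]
            · simp [hp]
        _ = ∑ s, ∑ W, ∑ V, (if supp q s = W then
              (if p W then (if rel q s V then 1 else 0) * (μ q * w s * c⁻¹) else 0) else 0) := by
            rw [Finset.sum_comm]
            rw [Finset.sum_congr rfl fun V _ => Finset.sum_comm]
            rw [Finset.sum_comm]
            exact Finset.sum_congr rfl fun s _ => Finset.sum_comm
        _ = ∑ s, (if p (supp q s) then n * (μ q * w s * c⁻¹) else 0) := by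
            refine Finset.sum_congr rfl fun s _ => ?_
            rw [Finset.sum_eq_single (supp q s)]
            · simp only [if_true]
              by_cases hp : p (supp q s)
              · simp only [hp, if_true]
                rw [← Finset.sum_mul, hrel q hq s]
              · simp [hp]
            · intro W _ hW
              simp [hW.symm]
            · simp
        _ = _ := by
            rw [Finset.mul_sum]
            refine Finset.sum_congr rfl fun s _ => ?_
            by_cases hp : p (supp q s)
            · simp only [hp, if_true]; ring
            · simp [hp]
  refine le_capacity_of_query hLD hDK hV hr (fun W V => PMF.ofFintype (f W V) (hf W V)) ans (a / b)
    (fun q i => ?_) (fun W V q hq => ?_)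
  · simp only [PMF.ofFintype_apply]
    have h2 := hsum q (fun _ => True)
    simp only [if_true, hw] at h2
    have h3 : (∑ W : Support K D, ∑ V, if i ∈ W.1 then f W V q else 0) =
        μ q * n * c⁻¹ * a := by
      rw [← hcover q i]
      convert hsum q (fun W => i ∈ W.1)
    rw [h3, h2, mul_left_comm, ENNReal.div_mul_cancel hb0 hb]
  · simp only [PMF.ofFintype_apply] at hq
    have h1 : ∑ s, (if supp q s = W ∧ rel q s V then μ q * w s else 0) ≠ 0 := left_ne_zero_of_mul hq
    obtain ⟨s, -, hs⟩ := Finset.exists_ne_zero_of_sum_ne_zero h1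
    have h2 : supp q s = W ∧ rel q s V := by
      by_contra h; exact hs (if_neg h)
    rw [if_pos h2] at hs
    obtain ⟨rfl, h3⟩ := h2
    exact hrec q s V (left_ne_zero_of_mul hs) h3

/-- The linear functionals in a subspace of dimension at most `r` can be evaluated given `r`
symbols. -/
theorem exists_encoding {I : Type*} [Fintype I] (C : Submodule F (I → F)) {r : ℕ}
    (hC : Module.finrank F C ≤ r) :
    ∃ enc : (I → E) → (Fin r → E), ∀ v ∈ C, ∀ Y Y', enc Y = enc Y' →
      ∑ i, algebraMap F E (v i) * Y i = ∑ i, algebraMap F E (v i) * Y' i := by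
  let bs := Module.finBasis F C
  -- Evaluate a basis of `C`; surplus symbols are padded with zero.
  refine ⟨fun Y m => if h : (m : ℕ) < Module.finrank F C then
    ∑ i, algebraMap F E ((bs ⟨m, h⟩ : I → F) i) * Y i else 0, fun v hv Y Y' h => ?_⟩
  have hb : ∀ m, ∑ i, algebraMap F E ((bs m : I → F) i) * Y i =
      ∑ i, algebraMap F E ((bs m : I → F) i) * Y' i := by
    intro m
    have := congrFun h ⟨m, m.2.trans_le hC⟩
    simpa using this
  have hv' : ∀ i, v i = ∑ m, bs.repr ⟨v, hv⟩ m * (bs m : I → F) i := by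
    intro i
    have h1 := congrArg (fun u : C => (u : I → F) i) (bs.sum_repr ⟨v, hv⟩)
    simp only [Submodule.coe_sum, Submodule.coe_smul, Finset.sum_apply, Pi.smul_apply,
      smul_eq_mul] at h1
    exact h1.symm
  have hexp : ∀ Y : I → E, ∑ i, algebraMap F E (v i) * Y i =
      ∑ m, algebraMap F E (bs.repr ⟨v, hv⟩ m) * ∑ i, algebraMap F E ((bs m : I → F) i) * Y i := by
    intro Y
    simp only [Finset.mul_sum]
    rw [Finset.sum_comm]
    refine Finset.sum_congr rfl fun i _ => ?_
    rw [hv' i, map_sum, Finset.sum_mul]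
    exact Finset.sum_congr rfl fun m _ => by rw [map_mul]; ring
  rw [hexp, hexp]
  exact Finset.sum_congr rfl fun m _ => by rw [hb]

/-- The set of values of an injective sequence of message indices. -/
def supportOf (b : Fin D ↪ Fin K) : Support K D :=
  ⟨Finset.univ.map b, by simp⟩

/-- The columns of `V` follow increasing message indices, whereas a slot lists its messages in its
own order; the permutation mediates between the two. -/
theorem exists_sorting_perm (b : Fin D ↪ Fin K) : ∃ τ : Equiv.Perm (Fin D),
    ∀ j, b j = (supportOf b).1.orderEmbOfFin (supportOf b).2 (τ j) := by
  have h : ∀ j, ∃ i, (supportOf b).1.orderEmbOfFin (supportOf b).2 i = b j := by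
    intro j
    have : b j ∈ Set.range ((supportOf b).1.orderEmbOfFin (supportOf b).2) := by
      rw [Finset.range_orderEmbOfFin]; simp [supportOf]
    exact this
  choose f hf using h
  have hinj : Function.Injective f := by
    intro i j hij
    apply b.injective
    rw [← hf, ← hf, hij]
  exact ⟨Equiv.ofBijective f (Finite.injective_iff_bijective.1 hinj), fun j => (hf j).symm⟩

/-- The permutation which sorts an injective sequence of message indices. -/
noncomputable def sortingPerm (b : Fin D ↪ Fin K) : Equiv.Perm (Fin D) :=
  (exists_sorting_perm b).choose

theorem demand_supportOf (b : Fin D ↪ Fin K) (V : MDSMatrix F L D) (X : Fin K → E) (l : Fin L) :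
    demand (supportOf b) V X l =
      ∑ j, algebraMap F E (V.1 l (sortingPerm b j)) * X (b j) := by
  unfold demand
  rw [Matrix.mulVec, dotProduct]
  symm
  refine Fintype.sum_equiv (sortingPerm b) _ _ fun j => ?_
  rw [(exists_sorting_perm b).choose_spec j]
  rfl

/-- The columns of an MDS generator matrix may be permuted. -/
def MDSMatrix.permute (hLD : L ≤ D) (τ : Equiv.Perm (Fin D)) :
    MDSMatrix F L D ≃ MDSMatrix F L D where
  toFun V := ⟨fun l j => V.1 l (τ j), (generatesMDS_iff hLD _).2
    (((generatesMDS_iff hLD _).1 V.2).comp τ.toEmbedding)⟩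
  invFun V := ⟨fun l j => V.1 l (τ.symm j), (generatesMDS_iff hLD _).2
    (((generatesMDS_iff hLD _).1 V.2).comp τ.symm.toEmbedding)⟩
  left_inv V := by apply Subtype.ext; funext l j; simp
  right_inv V := by apply Subtype.ext; funext l j; simp

/-- Permutations of the messages act transitively on the `D`-subsets. -/
theorem card_supportOf_eq {I : Type} [Fintype I] [DecidableEq I] (hI : Fintype.card I = K)
    (a : Fin D ↪ I) : ∃ N : ℕ, N ≠ 0 ∧ ∀ W : Support K D,
      (Finset.univ.filter fun σ : I ≃ Fin K =>
        supportOf (a.trans σ.toEmbedding) = W).card = N := by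
  classical
  let σ₀ : I ≃ Fin K := Fintype.equivFinOfCardEq hI
  let W₀ := supportOf (a.trans σ₀.toEmbedding)
  refine ⟨(Finset.univ.filter fun σ : I ≃ Fin K =>
    supportOf (a.trans σ.toEmbedding) = W₀).card, ?_, fun W => ?_⟩
  · rw [Finset.card_ne_zero]
    exact ⟨σ₀, by simp [W₀]⟩
  · obtain ⟨π, -, hπ⟩ := exists_perm_map_eq W.1 W₀.1 (W.2.trans W₀.2.symm)
    refine Finset.card_equiv (Equiv.equivCongr (Equiv.refl I) π) fun σ => ?_
    simp only [Finset.mem_filter, Finset.mem_univ, true_and]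
    have h1 : (supportOf (a.trans ((Equiv.equivCongr (Equiv.refl I) π) σ).toEmbedding)).1 =
        (supportOf (a.trans σ.toEmbedding)).1.map π.toEmbedding := by
      ext i
      simp [supportOf, Equiv.eq_symm_apply]
    rw [Subtype.ext_iff, Subtype.ext_iff, h1, ← hπ]
    exact (Finset.map_injective π.toEmbedding).eq_iff.symm

open Classical in
/-- The protocol in which the query consists of a random arrangement of the messages and a random
arc, from which the codes on the possible supports `a s` are read off. -/
theorem le_capacity_of_layout {I ι 𝒮 : Type} [Fintype I] [Fintype ι] [Fintype 𝒮] {k r : ℕ}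
    (hL : 1 ≤ L) (hLD : L ≤ D) (hDK : D ≤ K) (hV : Nonempty (MDSMatrix F L D)) (hr : 1 ≤ r)
    (hF : 2 ^ (2 ^ Fintype.card ι + 1) * (Fintype.card ι * 2 ^ Fintype.card ι) ≤ Fintype.card F)
    (hI : Fintype.card I = K) (a : 𝒮 → Fin D ↪ I) (e : 𝒮 → Fin D ↪ ι) (lam : 𝒮 → Fin D → F)
    (hlam : ∀ s j, lam s j ≠ 0) (w : 𝒮 → ℕ)
    (hcover : ∀ i, ∑ s, (if i ∈ Set.range (a s) then w s else 0) = D) (hw : ∑ s, w s = K)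
    (κ : Matrix (Fin L) (Fin D) F → (Fin D → Fin k → F) → Prop) (n m : ℕ) (hm : m ≠ 0)
    (hκn : ∀ y, ArcOn Finset.univ y → Nat.card {V : MDSMatrix F L D // κ V.1 y} = n)
    (hκm : ∀ V : MDSMatrix F L D,
      Nat.card {y : Fin D → Fin k → F // ArcOn Finset.univ y ∧ κ V.1 y} = m)
    (hC : ∀ x : ι → Fin k → F, ArcOn Finset.univ x → ∃ C : Submodule F (I → F),
      Module.finrank F C ≤ r ∧ ∀ s V, κ V (fun j => lam s j • x (e s j)) →
        ∀ l, Function.extend (a s) (V l) 0 ∈ C) :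
    ENNReal.ofReal ((L : ℝ) / r) ≤ capacity F E hDK hV := by
  obtain ⟨μ, hμarc, hμtop, hμ⟩ := exists_arc_weight (F := F) (ι := ι) k D hF
  choose C hCr hCmem using hC
  choose enc henc using fun x hx => exists_encoding (E := E) (C x hx) (hCr x hx)
  have hyarc : ∀ x : ι → Fin k → F, ArcOn Finset.univ x → ∀ s,
      ArcOn Finset.univ fun j => lam s j • x (e s j) := fun x hx s =>
    (hx.comp (e s)).smul (lam s) (hlam s)
  choose N hN0 hN using fun s => card_supportOf_eq hI (a s)
  let b : (I ≃ Fin K) → 𝒮 → Fin D ↪ Fin K := fun σ s => (a s).trans σ.toEmbedding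
  -- Each of the `m` arcs on `D` points compatible with `V` is the rescaled restriction of global
  -- arcs of total weight one.
  have hin : ∀ s (V : MDSMatrix F L D),
      ∑ x, (if κ V.1 (fun j => lam s j • x (e s j)) then μ x else 0) = m := by
    intro s V
    have h1 : ∀ y : Fin D → Fin k → F, ArcOn Finset.univ y →
        ∑ x, (if (fun j => lam s j • x (e s j)) = y then μ x else 0) = 1 := by
      intro y hy
      have h2 := hμ (e s) (fun j => (lam s j)⁻¹ • y j)
        (hy.smul _ fun j => inv_ne_zero (hlam s j))
      rw [tsum_fintype] at h2
      rw [← h2]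
      refine Finset.sum_congr rfl fun x _ => ?_
      congr 1
      rw [eq_iff_iff, funext_iff, funext_iff]
      refine forall_congr' fun j => ?_
      rw [Function.comp, eq_inv_smul_iff₀ (hlam s j)]
    calc ∑ x, (if κ V.1 (fun j => lam s j • x (e s j)) then μ x else 0)
        = ∑ x, ∑ y, (if ArcOn Finset.univ y ∧ κ V.1 y then
            (if (fun j => lam s j • x (e s j)) = y then μ x else 0) else 0) := by
          refine Finset.sum_congr rfl fun x _ => ?_
          rw [Finset.sum_eq_single (fun j => lam s j • x (e s j))]
          · by_cases hx : ArcOn Finset.univ x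
            · simp [hyarc x hx s]
            · have : μ x = 0 := by
                by_contra h; exact hx (hμarc x h)
              simp [this]
          · intro y _ hy
            simp [hy.symm]
          · simp
      _ = ∑ y, (if ArcOn Finset.univ y ∧ κ V.1 y then 1 else 0) := by
          rw [Finset.sum_comm]
          refine Finset.sum_congr rfl fun y _ => ?_
          by_cases hy : ArcOn Finset.univ y ∧ κ V.1 y
          · simp only [hy, and_self, if_true]
            exact h1 y hy.1
          · simp [hy]
      _ = m := by
          rw [← hκm V, Nat.card_eq_fintype_card, Fintype.card_subtype, Finset.sum_boole]
  refine le_capacity_of_design (𝒬 := (I ≃ Fin K) × (ι → Fin k → F)) (𝒮 := 𝒮) hLD hDK hV hr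
    -- Queries without an arc have weight zero, so their answer is immaterial.
    (fun q X => if hx : ArcOn Finset.univ q.2 then enc q.2 hx (X ∘ q.1) else 0)
    (fun q => μ q.2) (fun s => (w s : ℝ≥0∞)) (fun q s => supportOf (b q.1 s))
    (fun q s V => κ (MDSMatrix.permute hLD (sortingPerm (b q.1 s)) V).1
      fun j => lam s j • q.2 (e s j))
    -- For each slot `s`, `N s` arrangements put it on `W`, and for each of them the compatible arcs
    -- have weight `m`. The last two constants give the prior `D / K`.
    ((∑ s, w s * (N s * m) : ℕ) : ℝ≥0∞) n D K ?_ (ENNReal.natCast_ne_top _) ?_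
    (ENNReal.natCast_ne_top _) ?_ ?_ ?_ ?_ ?_
  · obtain ⟨s, -, hs⟩ : ∃ s ∈ (Finset.univ : Finset 𝒮), w s ≠ 0 := by
      apply Finset.exists_ne_zero_of_sum_ne_zero
      rw [hw]; omega
    have h1 : w s * (N s * m) ≤ ∑ s, w s * (N s * m) :=
      Finset.single_le_sum (f := fun s => w s * (N s * m)) (fun _ _ => Nat.zero_le _)
        (Finset.mem_univ s)
    have h2 : w s * (N s * m) ≠ 0 := mul_ne_zero hs (mul_ne_zero (hN0 s) hm)
    rw [Nat.cast_ne_zero]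
    omega
  · rw [Nat.cast_ne_zero]; omega
  · intro W V
    rw [Finset.sum_comm, Nat.cast_sum]
    refine Finset.sum_congr rfl fun s _ => ?_
    rw [Fintype.sum_prod_type]
    have h1 : ∀ σ : I ≃ Fin K, ∑ x : ι → Fin k → F, (if supportOf (b σ s) = W ∧
        κ (MDSMatrix.permute hLD (sortingPerm (b σ s)) V).1 (fun j => lam s j • x (e s j)) then
          μ x * (w s : ℝ≥0∞) else 0) =
        if supportOf (b σ s) = W then (m : ℝ≥0∞) * w s else 0 := by
      intro σ
      by_cases hσ : supportOf (b σ s) = W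
      · simp only [hσ, true_and, if_true]
        rw [← hin s (MDSMatrix.permute hLD (sortingPerm (b σ s)) V), Finset.sum_mul]
        exact Finset.sum_congr rfl fun x _ => by split_ifs <;> simp
      · simp [hσ]
    rw [Finset.sum_congr rfl fun σ _ => h1 σ, ← Finset.sum_filter, Finset.sum_const, hN s W,
      nsmul_eq_mul]
    push_cast
    ring
  · rintro ⟨σ, x⟩ hx s
    have hx' : ArcOn Finset.univ x := hμarc x hx
    rw [← hκn _ (hyarc x hx' s), Nat.card_eq_fintype_card, Fintype.card_subtype, Finset.sum_boole]
    congr 1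
    refine Finset.card_equiv (MDSMatrix.permute hLD (sortingPerm (b σ s))) fun V => ?_
    simp
  · rintro ⟨σ, x⟩ i
    refine Eq.trans ?_ (congrArg (Nat.cast : ℕ → ℝ≥0∞) (hcover (σ.symm i)))
    rw [Nat.cast_sum]
    refine Finset.sum_congr rfl fun s _ => ?_
    have : i ∈ (supportOf (b σ s)).1 ↔ σ.symm i ∈ Set.range (a s) := by
      simp only [supportOf, b, Finset.mem_map, Finset.mem_univ, true_and, Set.mem_range]
      refine exists_congr fun j => ?_
      simp [Equiv.eq_symm_apply]
    simp only [this]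
    split_ifs <;> simp
  · exact (Nat.cast_sum _ _).symm.trans (congrArg (Nat.cast : ℕ → ℝ≥0∞) hw)
  · rintro ⟨σ, x⟩ s V hx hκ X X' hA
    have hx' : ArcOn Finset.univ x := hμarc x hx
    simp only [hx', dif_pos] at hA
    funext l
    have h1 := henc x hx' _ (hCmem x hx' s _ hκ l) _ _ hA
    have h2 : ∀ X : Fin K → E, demand (supportOf (b σ s)) V X l =
        ∑ i, algebraMap F E (Function.extend (a s)
          ((MDSMatrix.permute hLD (sortingPerm (b σ s)) V).1 l) 0 i) * (X ∘ σ) i := by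
      intro X
      rw [demand_supportOf]
      rw [← Finset.sum_subset (Finset.subset_univ (Finset.univ.map (a s))), Finset.sum_map]
      · refine Finset.sum_congr rfl fun j _ => ?_
        rw [(a s).injective.extend_apply]
        rfl
      · intro i _ hi
        rw [Function.extend_apply' _ _ _ (by simpa using hi)]
        simp
    rw [h2, h2]
    exact h1

end Design

/-! ### The lower bound on the capacity -/

section Windows

variable {D n t d S : ℕ}

/-- The cyclic window of `d` consecutive groups of size `S`, starting at the group `s`. -/
def window (hd : d ≤ t) (θ : Fin D ≃ Fin d × Fin S) (s : ZMod t) :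
    Fin D ↪ ZMod t × Fin S where
  toFun j := (s + ((θ j).1 : ℕ), (θ j).2)
  inj' := by
    intro i j h
    obtain ⟨h1, h2⟩ := Prod.mk.inj h
    have h3 := (ZMod.natCast_eq_natCast_iff' _ _ _).1 (add_left_cancel h1)
    rw [Nat.mod_eq_of_lt ((θ i).1.2.trans_le hd), Nat.mod_eq_of_lt ((θ j).1.2.trans_le hd)] at h3
    exact θ.injective (Prod.ext (Fin.ext h3) h2)

theorem window_apply (hd : d ≤ t) (θ : Fin D ≃ Fin d × Fin S) (s : ZMod t) (j : Fin D) :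
    window hd θ s j = (s + ((θ j).1 : ℕ), (θ j).2) := rfl

theorem mem_range_window (hd : d ≤ t) (θ : Fin D ≃ Fin d × Fin S) (s : ZMod t)
    (i : ZMod t × Fin S) : i ∈ Set.range (window hd θ s) ↔ ∃ a : Fin d, s + (a : ℕ) = i.1 := by
  constructor
  · rintro ⟨j, rfl⟩; exact ⟨(θ j).1, rfl⟩
  · rintro ⟨a, ha⟩
    exact ⟨θ.symm (a, i.2), by rw [window_apply, Equiv.apply_symm_apply, ha]⟩

/-- With window weight `S`, this gives every message of the cycle the weight `d * S = D`. -/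
theorem card_add_natCast_eq [NeZero t] (hd : d ≤ t) (g : ZMod t)
    [DecidablePred fun s : ZMod t => ∃ a : Fin d, s + (a : ℕ) = g] :
    (Finset.univ.filter fun s : ZMod t => ∃ a : Fin d, s + (a : ℕ) = g).card = d := by
  have h1 : (Finset.univ.filter fun s : ZMod t => ∃ a : Fin d, s + (a : ℕ) = g) =
      Finset.univ.image fun a : Fin d => g - ((a : ℕ) : ZMod t) := by
    ext s
    simp only [Finset.mem_filter, Finset.mem_univ, true_and, Finset.mem_image]
    exact exists_congr fun a => by rw [sub_eq_iff_eq_add, eq_comm]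
  rw [h1, Finset.card_image_of_injective, Finset.card_univ, Fintype.card_fin]
  intro a b hab
  have h3 := (ZMod.natCast_eq_natCast_iff' _ _ _).1 (sub_right_injective hab)
  rw [Nat.mod_eq_of_lt (a.2.trans_le hd), Nat.mod_eq_of_lt (b.2.trans_le hd)] at h3
  exact Fin.ext h3

theorem card_window_mem [NeZero t] (hd : d ≤ t) (s : ZMod t)
    [DecidablePred fun g : ZMod t => ∃ a : Fin d, s + (a : ℕ) = g] :
    (Finset.univ.filter fun g : ZMod t => ∃ a : Fin d, s + (a : ℕ) = g).card = d := by
  have h1 : (Finset.univ.filter fun g : ZMod t => ∃ a : Fin d, s + (a : ℕ) = g) =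
      Finset.univ.image fun a : Fin d => s + ((a : ℕ) : ZMod t) := by
    ext g
    simp
  rw [h1, Finset.card_image_of_injective, Finset.card_univ, Fintype.card_fin]
  intro a b hab
  have h3 := (ZMod.natCast_eq_natCast_iff' _ _ _).1 (add_right_injective _ hab)
  rw [Nat.mod_eq_of_lt (a.2.trans_le hd), Nat.mod_eq_of_lt (b.2.trans_le hd)] at h3
  exact Fin.ext h3

/-- The possible demand supports: each of `n` blocks of size `D`, and the cyclic windows among the
remaining messages. -/
def place (hd : d ≤ t) (θ : Fin D ≃ Fin d × Fin S) :
    Fin n ⊕ ZMod t → Fin D ↪ (Fin n × Fin D) ⊕ (ZMod t × Fin S)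
  | Sum.inl j => ⟨fun x => Sum.inl (j, x), fun x y h => by simpa using h⟩
  | Sum.inr s => (window hd θ s).trans ⟨Sum.inr, Sum.inr_injective⟩

open Classical in
theorem place_cover [NeZero t] (hd : d ≤ t) (θ : Fin D ≃ Fin d × Fin S)
    (i : (Fin n × Fin D) ⊕ (ZMod t × Fin S)) :
    ∑ s : Fin n ⊕ ZMod t, (if i ∈ Set.range (place (n := n) hd θ s) then
      Sum.elim (fun _ => D) (fun _ => S) s else 0) = D := by
  have hD : D = d * S := by simpa using Fintype.card_congr θ
  rw [Fintype.sum_sum_type]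
  rcases i with ⟨j, x⟩ | i
  · have h1 : ∀ j', (Sum.inl (j, x) : (Fin n × Fin D) ⊕ (ZMod t × Fin S)) ∈
        Set.range (place (n := n) hd θ (Sum.inl j')) ↔ j' = j := by
      intro j'
      constructor
      · rintro ⟨y, hy⟩
        exact (Prod.mk.inj (Sum.inl_injective hy)).1
      · rintro rfl; exact ⟨x, rfl⟩
    have h2 : ∀ s, (Sum.inl (j, x) : (Fin n × Fin D) ⊕ (ZMod t × Fin S)) ∉
        Set.range (place (n := n) hd θ (Sum.inr s)) := by
      rintro s ⟨y, hy⟩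
      simp [place] at hy
    simp [h1, h2]
  · have h1 : ∀ j', (Sum.inr i : (Fin n × Fin D) ⊕ (ZMod t × Fin S)) ∉
        Set.range (place (n := n) hd θ (Sum.inl j')) := by
      rintro s ⟨y, hy⟩
      simp [place] at hy
    have h2 : ∀ s, (Sum.inr i : (Fin n × Fin D) ⊕ (ZMod t × Fin S)) ∈
        Set.range (place (n := n) hd θ (Sum.inr s)) ↔ ∃ a : Fin d, s + (a : ℕ) = i.1 := by
      intro s
      rw [← mem_range_window hd θ s i]
      simp [place]
    simp only [h1, h2, if_false, Finset.sum_const_zero, zero_add, Sum.elim_inr]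
    rw [← Finset.sum_filter, Finset.sum_const, card_add_natCast_eq hd, smul_eq_mul, ← hD]

variable {F E : Type u} [Field F] [Fintype F] [Field E] [Fintype E] [Algebra F E] {K L : ℕ}

/-- `P` is the code on a block and `Q` a space containing the zero-extended codes of all windows,
whence `n * dim P + dim Q` symbols suffice. The blocks all reuse the part of the arc on the window
at `0`; only the law on each single slot matters. -/
theorem le_capacity_of_windows [NeZero t] {k r : ℕ} (hd : d ≤ t) (θ : Fin D ≃ Fin d × Fin S)
    (hL : 1 ≤ L) (hLD : L ≤ D) (hDK : D ≤ K) (hV : Nonempty (MDSMatrix F L D)) (hr : 1 ≤ r)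
    (hF : 2 ^ (2 ^ (t * S) + 1) * (t * S * 2 ^ (t * S)) ≤ Fintype.card F)
    (hK : n * D + t * S = K) (lam : ZMod t → Fin D → F) (hlam : ∀ s j, lam s j ≠ 0)
    (κ : Matrix (Fin L) (Fin D) F → (Fin D → Fin k → F) → Prop) (N m : ℕ) (hm : m ≠ 0)
    (hκN : ∀ y, ArcOn Finset.univ y → Nat.card {V : MDSMatrix F L D // κ V.1 y} = N)
    (hκm : ∀ V : MDSMatrix F L D,
      Nat.card {y : Fin D → Fin k → F // ArcOn Finset.univ y ∧ κ V.1 y} = m)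
    (hPQ : ∀ x : ZMod t × Fin S → Fin k → F, ArcOn Finset.univ x →
      ∃ (P : Submodule F (Fin D → F)) (Q : Submodule F (ZMod t × Fin S → F)),
        n * Module.finrank F P + Module.finrank F Q ≤ r ∧
        (∀ V, κ V (x ∘ window hd θ 0) → ∀ l, V l ∈ P) ∧
        ∀ s V, κ V (fun j => lam s j • x (window hd θ s j)) →
          ∀ l, Function.extend (window hd θ s) (V l) 0 ∈ Q) :
    ENNReal.ofReal ((L : ℝ) / r) ≤ capacity F E hDK hV := by
  have hcard : Fintype.card (ZMod t × Fin S) = t * S := by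
    rw [Fintype.card_prod, ZMod.card, Fintype.card_fin]
  have hF' : 2 ^ (2 ^ Fintype.card (ZMod t × Fin S) + 1) *
      (Fintype.card (ZMod t × Fin S) * 2 ^ Fintype.card (ZMod t × Fin S)) ≤ Fintype.card F := by
    rw [hcard]; exact hF
  refine le_capacity_of_layout (I := (Fin n × Fin D) ⊕ (ZMod t × Fin S)) (ι := ZMod t × Fin S)
    (𝒮 := Fin n ⊕ ZMod t) hL hLD hDK hV hr hF' ?_ (place hd θ)
    (Sum.elim (fun _ => window hd θ 0) (window hd θ)) (Sum.elim (fun _ _ => 1) lam) ?_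
    (Sum.elim (fun _ => D) fun _ => S) (fun i => by convert place_cover hd θ i) ?_ κ N m hm hκN hκm ?_
  · rw [Fintype.card_sum, hcard, Fintype.card_prod, Fintype.card_fin, Fintype.card_fin, hK]
  · rintro (j | s) i
    · exact one_ne_zero
    · exact hlam s i
  · rw [Fintype.sum_sum_type]
    simp [ZMod.card, hK]
  · intro x hx
    obtain ⟨P, Q, hdim, hP, hQ⟩ := hPQ x hx
    let Ψ : ((Fin n → P) × Q) →ₗ[F] ((Fin n × Fin D) ⊕ (ZMod t × Fin S) → F) :=
      { toFun := fun p => Sum.elim (fun i => (p.1 i.1 : Fin D → F) i.2)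
          (p.2 : ZMod t × Fin S → F)
        map_add' := fun p p' => by
          funext i
          rcases i with i | i <;> rfl
        map_smul' := fun c p => by
          funext i
          rcases i with i | i <;> rfl }
    refine ⟨LinearMap.range Ψ, ?_, ?_⟩
    · refine (LinearMap.finrank_range_le Ψ).trans (le_trans (le_of_eq ?_) hdim)
      rw [Module.finrank_prod, Module.finrank_pi_fintype]
      simp
    · rintro (j | s) V hκ l
      · have hmem : V l ∈ P := by
          refine hP V ?_ l
          convert hκ using 1
          funext i
          simp
        refine ⟨(Pi.single j ⟨V l, hmem⟩, 0), ?_⟩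
        funext i
        rcases i with ⟨j', y⟩ | i
        · by_cases hj : j' = j
          · subst hj
            rw [show (Sum.inl (j', y) : (Fin n × Fin D) ⊕ (ZMod t × Fin S)) =
              place hd θ (Sum.inl j') y from rfl, (place hd θ (Sum.inl j')).injective.extend_apply]
            change ((Pi.single j' ⟨V l, hmem⟩ : Fin n → P) j' : Fin D → F) y = V l y
            rw [Pi.single_eq_same]
          · rw [Function.extend_apply']
            · simp [Ψ, hj]
            · rintro ⟨z, hz⟩
              exact hj (Prod.mk.inj (Sum.inl_injective hz)).1.symm
        · rw [Function.extend_apply']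
          · simp [Ψ]
          · rintro ⟨z, hz⟩
            simp [place] at hz
      · refine ⟨(0, ⟨_, hQ s V hκ l⟩), ?_⟩
        funext i
        rcases i with ⟨j', y⟩ | i
        · rw [Function.extend_apply']
          · simp [Ψ]
          · rintro ⟨z, hz⟩
            simp [place] at hz
        · by_cases hi : i ∈ Set.range (window hd θ s)
          · obtain ⟨z, rfl⟩ := hi
            rw [show (Sum.inr (window hd θ s z) : (Fin n × Fin D) ⊕ (ZMod t × Fin S)) =
              place hd θ (Sum.inr s) z from rfl, (place hd θ (Sum.inr s)).injective.extend_apply]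
            simp [Ψ, place, (window hd θ s).injective.extend_apply]
          · rw [Function.extend_apply']
            · simp only [Ψ, LinearMap.coe_mk, AddHom.coe_mk, Sum.elim_inr]
              rw [Function.extend_apply' _ _ _ hi]
              rfl
            · rintro ⟨z, hz⟩
              exact hi ⟨z, by simpa [place] using hz⟩

/-- The protocol in which the codes on the windows are multiples of the same generator matrix. -/
theorem le_capacity_of_aligned [NeZero t] (hd : d ≤ t) (hS : 1 ≤ S) (θ : Fin D ≃ Fin d × Fin S)
    (hL : 1 ≤ L) (hLD : L ≤ D) (hDK : D ≤ K) (hV : Nonempty (MDSMatrix F L D))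
    (hF : 2 ^ (2 ^ (t * S) + 1) * (t * S * 2 ^ (t * S)) ≤ Fintype.card F)
    (hK : n * D + t * S = K) :
    ENNReal.ofReal ((L : ℝ) / (n * L + L * (t - d + 1) : ℕ)) ≤ capacity F E hDK hV := by
  classical
  have htF : t ≤ Fintype.card F := by
    refine le_trans ?_ hF
    calc t = 1 * (t * 1 * 1) := by ring
      _ ≤ _ := Nat.mul_le_mul Nat.one_le_two_pow
        (Nat.mul_le_mul (Nat.mul_le_mul_left t hS) Nat.one_le_two_pow)
  obtain ⟨α⟩ : Nonempty (ZMod t ↪ F) := by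
    rw [Function.Embedding.nonempty_iff_card_le, ZMod.card]; exact htF
  -- With one field element per group, `f s` vanishes exactly at the groups outside the window `s`,
  -- and has degree `t - d`. Its values are the multipliers `lam`.
  let f : ZMod t → Polynomial F := fun s =>
    ∏ h ∈ Finset.univ.filter (fun h => ¬ ∃ a : Fin d, s + (a : ℕ) = h),
      (Polynomial.X - Polynomial.C (α h))
  have hdeg : ∀ s, (f s).natDegree < t - d + 1 := by
    intro s
    have h1 := Finset.card_filter_add_card_filter_not (s := (Finset.univ : Finset (ZMod t)))
      (fun h => ∃ a : Fin d, s + (a : ℕ) = h)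
    rw [card_window_mem hd, Finset.card_univ, ZMod.card] at h1
    rw [Polynomial.natDegree_finsetProd_X_sub_C_eq_card]
    omega
  have hzero : ∀ s g, (Polynomial.eval (α g) (f s) = 0) ↔ ¬ ∃ a : Fin d, s + (a : ℕ) = g := by
    intro s g
    rw [Polynomial.eval_prod, Finset.prod_eq_zero_iff]
    simp only [Finset.mem_filter, Finset.mem_univ, true_and, Polynomial.eval_sub,
      Polynomial.eval_X, Polynomial.eval_C, sub_eq_zero, α.injective.eq_iff]
    constructor
    · rintro ⟨h, hh, rfl⟩; exact hh
    · intro h; exact ⟨g, h, rfl⟩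
  refine le_capacity_of_windows (k := L) hd θ hL hLD hDK hV ?_ hF hK
    (fun s j => Polynomial.eval (α (window hd θ s j).1) (f s)) (fun s j => ?_)
    -- The matrix is the transposed arc, so compatibility is a bijection and both counts are one.
    (fun V y => ∀ l j, V l j = y j l) 1 1 one_ne_zero (fun y hy => ?_) (fun V => ?_)
    (fun x hx => ?_)
  · have : 1 ≤ L * (t - d + 1) := Nat.mul_pos hL (Nat.succ_pos _)
    omega
  · rw [ne_eq, hzero, not_not]
    exact ⟨(θ j).1, rfl⟩
  · rw [Nat.card_eq_one_iff_unique]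
    refine ⟨⟨fun V V' => ?_⟩, ⟨⟨⟨fun l j => y j l, (generatesMDS_iff hLD _).2 hy⟩,
      fun l j => rfl⟩⟩⟩
    apply Subtype.ext; apply Subtype.ext
    funext l j
    rw [V.2, V'.2]
  · rw [Nat.card_eq_one_iff_unique]
    refine ⟨⟨fun y y' => ?_⟩, ⟨⟨fun j l => V.1 l j, (generatesMDS_iff hLD _).1 V.2,
      fun l j => rfl⟩⟩⟩
    apply Subtype.ext
    funext j l
    rw [← y.2.2, ← y'.2.2]
  · let g : Fin L × Fin (t - d + 1) → ZMod t × Fin S → F := fun p i =>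
      α i.1 ^ (p.2 : ℕ) * x i p.1
    refine ⟨Submodule.span F (Set.range fun (l : Fin L) j => x (window hd θ 0 j) l),
      Submodule.span F (Set.range g), ?_, ?_, ?_⟩
    · have h1 := finrank_range_le_card (R := F) (fun (l : Fin L) j => x (window hd θ 0 j) l)
      have h2 := finrank_range_le_card (R := F) g
      rw [Set.finrank, Fintype.card_fin] at h1
      rw [Set.finrank, Fintype.card_prod, Fintype.card_fin, Fintype.card_fin] at h2
      exact Nat.add_le_add (Nat.mul_le_mul_left n h1) h2
    · intro V hκ l
      refine Submodule.subset_span ⟨l, ?_⟩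
      funext j
      exact (hκ l j).symm
    · intro s V hκ l
      -- Expanding `f s` in monomials puts every zero-extended row in the span of the `L * (t - d +
      -- 1)` functions `g`, common to all windows.
      have h1 : Function.extend (window hd θ s) (V l) 0 =
          ∑ a : Fin (t - d + 1), (f s).coeff a • g (l, a) := by
        have h2 : ∀ i, (∑ a : Fin (t - d + 1), (f s).coeff a • g (l, a)) i =
            Polynomial.eval (α i.1) (f s) * x i l := by
          intro i
          rw [Polynomial.eval_eq_sum_range' (hdeg s), Finset.sum_mul, Finset.sum_range,
            Finset.sum_apply]
          exact Finset.sum_congr rfl fun a _ => by simp [g, mul_assoc]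
        funext i
        rw [h2]
        by_cases hi : i ∈ Set.range (window hd θ s)
        · obtain ⟨j, rfl⟩ := hi
          rw [(window hd θ s).injective.extend_apply, hκ l j]
          rfl
        · rw [Function.extend_apply' _ _ _ hi]
          rw [mem_range_window] at hi
          rw [(hzero s i.1).2 hi, zero_mul]
          rfl
      rw [h1]
      exact Submodule.sum_mem _ fun a _ => Submodule.smul_mem _ _
        (Submodule.subset_span ⟨(l, a), rfl⟩)

/-- The protocol in which the codes on the windows are shortenings of one long MDS code. -/
theorem le_capacity_of_shortened [NeZero t] (hd : d ≤ t) (θ : Fin D ≃ Fin d × Fin S)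
    (hL : 1 ≤ L) (hLD : L ≤ D) (hDK : D ≤ K) (hV : Nonempty (MDSMatrix F L D))
    (hF : 2 ^ (2 ^ (t * S) + 1) * (t * S * 2 ^ (t * S)) ≤ Fintype.card F)
    (hK : n * D + t * S = K) :
    ENNReal.ofReal ((L : ℝ) / (n * L + (t * S - (D - L)) : ℕ)) ≤ capacity F E hDK hV := by
  classical
  have hcard : Fintype.card (ZMod t × Fin S) = t * S := by
    rw [Fintype.card_prod, ZMod.card, Fintype.card_fin]
  have hDN : D ≤ t * S := by
    have := Fintype.card_le_of_embedding (window hd θ 0)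
    rwa [hcard, Fintype.card_fin] at this
  have hsum : D - L + L = Fintype.card (Fin D) := by rw [Fintype.card_fin]; omega
  refine le_capacity_of_windows (k := D - L) hd θ hL hLD hDK hV ?_ hF hK
    (fun s j => 1) (fun s j => one_ne_zero)
    -- The arc is a parity check matrix in dimension `D - L`. Both counts, of matrices per arc and
    -- of arcs per matrix, come from `card_dual`.
    (fun V y => ∀ m l, ∑ j, y j m * V l j = 0)
    (∏ i : Fin L, (Fintype.card F ^ L - Fintype.card F ^ (i : ℕ)))
    (∏ i : Fin (D - L), (Fintype.card F ^ (D - L) - Fintype.card F ^ (i : ℕ))) ?_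
    (fun y hy => ?_) (fun V => ?_) (fun x hx => ?_)
  · omega
  · rw [Finset.prod_ne_zero_iff]
    intro i _
    have := Nat.pow_lt_pow_right (Fintype.one_lt_card (α := F)) i.2
    omega
  · rw [← card_dual hsum hy]
    refine Nat.card_congr ⟨fun V => ⟨fun j l => V.1.1 l j, (generatesMDS_iff hLD _).1 V.1.2, V.2⟩,
      fun y => ⟨⟨fun l j => y.1 j l, (generatesMDS_iff hLD _).2 y.2.1⟩, y.2.2⟩,
      fun V => rfl, fun y => rfl⟩
  · rw [← card_dual (add_comm (D - L) L ▸ hsum) ((generatesMDS_iff hLD _).1 V.2)]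
    refine Nat.card_congr (Equiv.subtypeEquivRight fun y => and_congr_right fun _ => ?_)
    rw [forall_comm]
    refine forall_congr' fun l => forall_congr' fun m => ?_
    rw [Finset.sum_congr rfl fun j _ => mul_comm (y j m) (V.1 l j)]
  -- The long code is the kernel of `x`, of dimension `t * S - (D - L)`. A word checked by the
  -- restriction of `x` to a window remains in the long code after extension by zero.
  · refine ⟨LinearMap.ker (Fintype.linearCombination F (x ∘ window hd θ 0)),
      LinearMap.ker (Fintype.linearCombination F x), ?_, ?_, ?_⟩
    · rw [(hx.comp _).finrank_ker (by rw [Fintype.card_fin]; omega),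
        hx.finrank_ker (by rw [hcard]; omega), hcard, Fintype.card_fin,
        Nat.sub_sub_self hLD]
    · intro V hκ l
      rw [LinearMap.mem_ker, Fintype.linearCombination_apply]
      funext m
      rw [Finset.sum_apply, Pi.zero_apply, ← hκ m l]
      exact Finset.sum_congr rfl fun j _ => mul_comm _ _
    · intro s V hκ l
      rw [LinearMap.mem_ker, Fintype.linearCombination_apply]
      rw [← Finset.sum_subset (Finset.subset_univ (Finset.univ.map (window hd θ s))),
        Finset.sum_map]
      · funext m
        rw [Finset.sum_apply, Pi.zero_apply, ← hκ m l]
        refine Finset.sum_congr rfl fun j _ => ?_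
        rw [(window hd θ s).injective.extend_apply]
        simp [mul_comm]
      · intro i _ hi
        rw [Function.extend_apply' _ _ _ (by simpa using hi)]
        simp

end Windows

/-! ### Comparison and attainment of the numerical bounds -/

section Bounds

variable {K D L : ℕ}

/-- For `R > 0`, `S ≤ R` makes `R / S ≥ 1`, so `R ≤ L` turns both minima into `R / L`; if `R ∣ D`
then `S = R`. For `R = 0` both minima vanish. -/
theorem lowerBound_eq_upperBound (hL : 1 ≤ L) (h : K % D ≤ L ∨ K % D ∣ D) :
    lowerBound K D L = upperBound K D L := by
  unfold lowerBound upperBound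
  have hL' : (0 : ℝ) < L := by exact_mod_cast hL
  rcases Nat.eq_zero_or_pos (K % D) with h0 | h0
  · simp [h0]
  have hS : 0 < Nat.gcd (D + K % D) (K % D) := Nat.gcd_pos_of_pos_right _ h0
  have hS' : (0 : ℝ) < Nat.gcd (D + K % D) (K % D) := by exact_mod_cast hS
  rcases h with h | h
  · have h1 : ((K % D : ℕ) : ℝ) / L ≤ 1 := by
      rw [div_le_one hL']; exact_mod_cast h
    have h2 : (1 : ℝ) ≤ ((K % D : ℕ) : ℝ) / Nat.gcd (D + K % D) (K % D) := by
      rw [one_le_div hS']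
      exact_mod_cast Nat.gcd_le_right _ h0
    rw [min_eq_right h1, min_eq_right (h1.trans h2)]
  · have h1 : Nat.gcd (D + K % D) (K % D) = K % D :=
      Nat.gcd_eq_right (dvd_add h dvd_rfl)
    rw [h1, div_self (by exact_mod_cast h0.ne')]

theorem upperBound_eq (hL : 1 ≤ L) :
    upperBound K D L = (L : ℝ) / (L * (K / D) + min L (K % D) : ℕ) := by
  have hL' : (0 : ℝ) < L := by exact_mod_cast hL
  unfold upperBound
  have h1 : ((L * (K / D) + min L (K % D) : ℕ) : ℝ) =
      L * (((K / D : ℕ) : ℝ) + min 1 (((K % D : ℕ) : ℝ) / L)) := by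
    rw [mul_add, mul_min_of_nonneg _ _ hL'.le, mul_one, mul_div_cancel₀ _ hL'.ne']
    push_cast
    rfl
  rw [h1, div_mul_eq_div_div, div_self hL'.ne', one_div]

variable {F E : Type u} [Field F] [Fintype F] [Field E] [Fintype E] [Algebra F E]

theorem lowerBound_le_capacity (hL : 1 ≤ L) (hLD : L ≤ D) (hDK : D ≤ K)
    (hV : Nonempty (MDSMatrix F L D))
    (hF : 2 ^ (2 ^ K + 1) * (K * 2 ^ K) ≤ Fintype.card F) :
    ENNReal.ofReal (lowerBound K D L) ≤ capacity F E hDK hV := by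
  have hD : 0 < D := by omega
  have hL' : (0 : ℝ) < L := by exact_mod_cast hL
  have hdiv : 1 ≤ K / D := (Nat.one_le_div_iff hD).2 hDK
  have hmod := Nat.div_add_mod K D
  unfold lowerBound
  set R := K % D with hR
  set S := Nat.gcd (D + R) R with hS
  have hS0 : 0 < S := Nat.gcd_pos_of_pos_left _ (by omega)
  have hS' : (0 : ℝ) < S := by exact_mod_cast hS0
  obtain ⟨ρ, hρ⟩ : S ∣ R := Nat.gcd_dvd_right _ _
  obtain ⟨d, hd⟩ : S ∣ D := (Nat.dvd_add_left ⟨ρ, hρ⟩).1 (Nat.gcd_dvd_left (D + R) R)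
  have hd0 : d ≠ 0 := by rintro rfl; omega
  -- One of the `K / D` full blocks is merged with the remainder into the cycle of `D + R` messages.
  -- For `R = 0` this gives `S = D` and a cycle of a single group.
  obtain ⟨n, hn⟩ : ∃ n, K / D = n + 1 := ⟨K / D - 1, by omega⟩
  have hNt : NeZero (d + ρ) := ⟨by omega⟩
  have htS : (d + ρ) * S = D + R := by
    rw [add_mul, mul_comm d, mul_comm ρ, ← hd, ← hρ]
  have hK : n * D + (d + ρ) * S = K := by
    rw [htS]
    rw [hn, mul_add, mul_comm D n] at hmod
    omega
  have hle : (d + ρ) * S ≤ K := by omega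
  have hF' : 2 ^ (2 ^ ((d + ρ) * S) + 1) * ((d + ρ) * S * 2 ^ ((d + ρ) * S)) ≤ Fintype.card F := by
    refine le_trans ?_ hF
    have h1 : 2 ^ ((d + ρ) * S) ≤ 2 ^ K := Nat.pow_le_pow_right (by norm_num) hle
    exact Nat.mul_le_mul (Nat.pow_le_pow_right (by norm_num) (by omega)) (Nat.mul_le_mul hle h1)
  let θ : Fin D ≃ Fin d × Fin S := Fintype.equivOfCardEq (by
    rw [Fintype.card_prod, Fintype.card_fin, Fintype.card_fin, Fintype.card_fin, hd, mul_comm])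
  have hRS : (R : ℝ) / S = ρ := by
    rw [hρ]; push_cast; field_simp
  -- The smaller of `R / S` and `R / L` decides which construction is used.
  rcases le_total L S with hLS | hLS
  · have h1 := le_capacity_of_aligned (E := E) (n := n) (t := d + ρ) (d := d) (by omega) hS0 θ hL hLD hDK hV
      hF' hK
    refine le_trans (ENNReal.ofReal_le_ofReal (le_of_eq ?_)) h1
    have h2 : (R : ℝ) / S ≤ R / L :=
      div_le_div_of_nonneg_left (by positivity) hL' (by exact_mod_cast hLS)
    rw [min_eq_left h2, hRS, hn, Nat.add_sub_cancel_left]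
    have h3 : ((n * L + L * (ρ + 1) : ℕ) : ℝ) = L * (((n + 1 : ℕ) : ℝ) + ρ) := by
      push_cast; ring
    rw [h3, div_mul_eq_div_div, div_self hL'.ne', one_div]
  · have h1 := le_capacity_of_shortened (E := E) (n := n) (t := d + ρ) (d := d) (by omega) θ hL hLD hDK hV
      hF' hK
    refine le_trans (ENNReal.ofReal_le_ofReal (le_of_eq ?_)) h1
    have h2 : (R : ℝ) / L ≤ R / S :=
      div_le_div_of_nonneg_left (by positivity) hS' (by exact_mod_cast hLS)
    rw [min_eq_right h2, hn, htS]
    have h3 : n * L + (D + R - (D - L)) = L * (n + 1) + R := by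
      rw [mul_add, mul_comm L n]; omega
    have h4 : ((L * (n + 1) + R : ℕ) : ℝ) = L * (((n + 1 : ℕ) : ℝ) + R / L) := by
      push_cast; field_simp
    rw [h3, h4, div_mul_eq_div_div, div_self hL'.ne', one_div]

theorem nonempty_MDSMatrix (hLD : L ≤ D) (hF : D * 2 ^ D < Fintype.card F) :
    Nonempty (MDSMatrix F L D) := by
  obtain ⟨x, hx⟩ := exists_arc (F := F) (ι := Fin D) (k := L) (by rwa [Fintype.card_fin])
  exact ⟨⟨fun l j => x j l, (generatesMDS_iff hLD _).2 hx⟩⟩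

end Bounds

end IPLT

theorem theorem1 (K D L : ℕ) (hL : 1 ≤ L) (hLD : L ≤ D) (hDK : D ≤ K) :
    (∀ (F E : Type u) [Field F] [Fintype F] [Field E] [Fintype E] [Algebra F E]
        (hV : Nonempty (IPLT.MDSMatrix F L D)),
        IPLT.capacity F E hDK hV ≤ ENNReal.ofReal (IPLT.upperBound K D L)) ∧
    (∃ N : ℕ, ∀ (F E : Type u) [Field F] [Fintype F] [Field E] [Fintype E] [Algebra F E],
        N ≤ Fintype.card F →
        ∃ hV : Nonempty (IPLT.MDSMatrix F L D),
          ENNReal.ofReal (IPLT.lowerBound K D L) ≤ IPLT.capacity F E hDK hV) ∧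
    (K % D ≤ L ∨ K % D ∣ D → IPLT.lowerBound K D L = IPLT.upperBound K D L) := by
  -- The threshold is that of `exists_arc_weight` with `K` in place of the at most `K` points of the
  -- cycle; the summand one helps to obtain the strict bound for `nonempty_MDSMatrix`.
  refine ⟨fun F E _ _ _ _ _ hV => ?_, ⟨2 ^ (2 ^ K + 1) * (K * 2 ^ K) + 1,
    fun F E _ _ _ _ _ hF => ?_⟩, IPLT.lowerBound_eq_upperBound hL⟩
  · rw [IPLT.upperBound_eq hL]
    exact IPLT.capacity_le hL hLD hDK hV
  · have hlt : D * 2 ^ D < Fintype.card F := by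
      have h1 : D * 2 ^ D ≤ K * 2 ^ K :=
        Nat.mul_le_mul hDK (Nat.pow_le_pow_right (by norm_num) hDK)
      have h2 : K * 2 ^ K ≤ 2 ^ (2 ^ K + 1) * (K * 2 ^ K) :=
        Nat.le_mul_of_pos_left _ (by positivity)
      omega
    exact ⟨IPLT.nonempty_MDSMatrix hLD hlt,
      IPLT.lowerBound_le_capacity hL hLD hDK _ (by omega)⟩
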